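/- Let $K$ be a field. A duplicial algebra is a $K$-vector space $A$ with bilinear products $/,\backslash$ such that $x/(y/z)=(x/y)/z$, $x/(y\backslash z)=(x/y)\backslash z$ and $x\backslash(y\backslash z)=(x\backslash y)\backslash z$. A duplicial bialgebra is a duplicial algebra with a coassociative (not necessarily counital) coproduct $\Delta:A\to A\otimes A$ such that, with $\Delta(x)=\sum x_{(1)}\otimes x_{(2)}$, for both $*\in\{/,\backslash\}$ and all $x,y\in A$, $$\Delta(x*y)=\sum x_{(1)}\otimes (x_{(2)}*y)+\sum (x*y_{(1)})\otimes y_{(2)}+x\otimes y .$$ Put $\{x,y\}:=x\backslash y-x/y$ and $\mathrm{Prim}(A):=\ker\Delta$, which is closed under $\{-,-\}$. The bialgebra $A$ is connected if $A=\bigcup_{p\ge1}F_pA$, where $F_1A=\mathrm{Prim}(A)$ and $F_{p+1}A=\{x:\Delta(x)\in F_pA\otimes F_pA\}$. A magmatic algebra is a vector space $M$ with a bilinear map $\cdot:M\times M\to M$. For a set $E$, let $\mathrm{Dup}(E)$ be the free duplicial algebra on $E$: the vector space with basis the planar binary rooted trees with at least one internal vertex, internal vertices coloured by $E$, where $t/s$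 is obtained by grafting $t$ on the leftmost leaf of $s$, and $t\backslash s$ by grafting $s$ on the rightmost leaf of $t$. An element $e\in E$ is identified with the one-vertex tree coloured by $e$. It is a duplicial bialgebra whose coproduct is given recursively, for a tree with root coloured by $e$ and left and right subtrees $t,w$, by $$\Delta(t\vee_e w)=\sum t_{(1)}\otimes(t_{(2)}\vee_e w)+t\otimes(|\vee_e w)+(t\vee_e|)\otimes w+\sum(t\vee_e w_{(1)})\otimes w_{(2)},$$ where $|$ is the tree without internal vertices, $\Delta(|)=0$, and a term that has $|$ as a tensor factor is omitted. For a magmatic algebra $(M,\cdot)$ with a vector space basis $B$, regard $M=K[B]$ as a subspace of $\mathrm{Dup}(B)$; the universal duplicial enveloping algebra $U_{dup}(M)$ is the quotient of $\mathrm{Dup}(B)$ by the duplicial ideal spanned by the elements $\{x,y\}-x\cdot y$, $x,y\in M$, with the induced duplicial bialgebra structure. Then: (a) If $A$ is a connected duplicial bialgebra, then (for every choice of basis of $\mathrm{Prim}(A)$) there is an isomorphism of duplicial bialgebras $U_{dup}(\mathrm{Prim}(A))\cong A$, where $\mathrm{Prim}(A)$ is the magmatic algebra of primitive elements with the bracket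 $\{-,-\}$, which restricts to the identity on $\mathrm{Prim}(A)$, that is, sends the class of each $x\in\mathrm{Prim}(A)$ to $x$. (b) If $(M,\cdot)$ is a magmatic algebra, then (for every choice of basis of $M$) the canonical map $M\to U_{dup}(M)$ induces an isomorphism of magmatic algebras from $(M,\cdot)$ onto $(\mathrm{Prim}(U_{dup}(M)),\{-,-\})$. (c) For every set $E$, $(\mathrm{Prim}(\mathrm{Dup}(E)),\{-,-\})$ is the free magmatic algebra on $E$: for every magmatic algebra $(N,\cdot)$ and every map $f:E\to N$ there is a unique linear map $\theta:\mathrm{Prim}(\mathrm{Dup}(E))\to N$ with $\theta(\{x,y\})=\theta(x)\cdot\theta(y)$ for all $x,y$ and $\theta(e)=f(e)$ for all $e\in E$. -/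

import Mathlib

open scoped TensorProduct

universe u v w w'

/-! ### Duplicial algebras and duplicial bialgebras -/

/-- A duplicial algebra over `K`: a vector space with two bilinear products,
`slash x y` (written `x / y`) and `bslash x y` (written `x \ y`). -/
class DuplicialAlgebra (K : Type u) (A : Type v) [Field K] [AddCommGroup A] [Module K A] where
  slash : A →ₗ[K] A →ₗ[K] A
  bslash : A →ₗ[K] A →ₗ[K] A
  slash_slash : ∀ x y z : A, slash x (slash y z) = slash (slash x y) z
  slash_bslash : ∀ x y z : A, slash x (bslash y z) = bslash (slash x y) z
  bslash_bslash : ∀ x y z : A, bslash x (bslash y z) = bslash (bslash x y) z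

/-- The right-hand side
`∑ x₍₁₎ ⊗ (x₍₂₎ * y) + ∑ (x * y₍₁₎) ⊗ y₍₂₎ + x ⊗ y` of the nonunital infinitesimal relation
between a bilinear product `*` and a coproduct `Δ`. -/
noncomputable def infinitesimalRHS {K : Type u} {A : Type v} [Field K] [AddCommGroup A]
    [Module K A] (mul : A →ₗ[K] A →ₗ[K] A) (Δ : A →ₗ[K] A ⊗[K] A) (x y : A) : A ⊗[K] A :=
  (mul.flip y).lTensor A (Δ x) + (mul x).rTensor A (Δ y) + x ⊗ₜ[K] y

/-- A duplicial bialgebra: a duplicial algebra with a coassociative (not counital) admissible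
coproduct. -/
class DuplicialBialgebra (K : Type u) (A : Type v) [Field K] [AddCommGroup A] [Module K A]
    extends DuplicialAlgebra K A where
  comul : A →ₗ[K] A ⊗[K] A
  coassoc : ∀ x : A, TensorProduct.assoc K A A A (comul.rTensor A (comul x)) =
    comul.lTensor A (comul x)
  comul_slash : ∀ x y : A, comul (slash x y) = infinitesimalRHS slash comul x y
  comul_bslash : ∀ x y : A, comul (bslash x y) = infinitesimalRHS bslash comul x y

namespace Duplicial

section Basics

variable (K : Type u) {A : Type v} [Field K] [AddCommGroup A] [Module K A]

/-- The bracket `{x, y} = x \ y - x / y`. -/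
def bracket [DuplicialAlgebra K A] : A →ₗ[K] A →ₗ[K] A :=
  DuplicialAlgebra.bslash - DuplicialAlgebra.slash

variable (A)

/-- The subspace of primitive elements, `Δ x = 0`. -/
def Prim [DuplicialBialgebra K A] : Submodule K A :=
  LinearMap.ker (DuplicialBialgebra.comul (K := K) (A := A))

/-- The filtration `F₁ = Prim A`, `F_{p+1} = {x | Δ x ∈ F_p ⊗ F_p}`; here
`coradicalFiltration K A n` is `F_{n+1}`. -/
noncomputable def coradicalFiltration [DuplicialBialgebra K A] : ℕ → Submodule K A
  | 0 => Prim K A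
  | n + 1 => (LinearMap.range (TensorProduct.map (coradicalFiltration n).subtype
      (coradicalFiltration n).subtype)).comap DuplicialBialgebra.comul

/-- The bialgebra is connected when the filtration exhausts it. -/
def IsConnected [DuplicialBialgebra K A] : Prop :=
  ∀ x : A, ∃ n, x ∈ coradicalFiltration K A n

variable {A}

theorem bracket_mem_prim [DuplicialBialgebra K A] {x y : A} (hx : x ∈ Prim K A)
    (hy : y ∈ Prim K A) : bracket K x y ∈ Prim K A := by
  simp only [Prim, LinearMap.mem_ker] at hx hy ⊢
  simp [bracket, DuplicialBialgebra.comul_slash, DuplicialBialgebra.comul_bslash,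
    infinitesimalRHS, hx, hy]

variable (A)

/-- The magmatic algebra structure on the primitive elements: the bracket restricted to
`Prim A`. -/
def primBracket [DuplicialBialgebra K A] : Prim K A →ₗ[K] Prim K A →ₗ[K] Prim K A :=
  LinearMap.mk₂ K (fun x y => ⟨bracket K (x : A) (y : A), bracket_mem_prim K x.2 y.2⟩)
    (fun _ _ _ => by ext; simp) (fun _ _ _ => by ext; simp)
    (fun _ _ _ => by ext; simp) (fun _ _ _ => by ext; simp)

variable {A} in
/-- An isomorphism of duplicial bialgebras: a linear equivalence that is compatible with both
products and with the coproducts. -/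
structure IsBialgebraIso {B : Type w} [AddCommGroup B] [Module K B]
    [DuplicialBialgebra K A] [DuplicialBialgebra K B] (φ : A ≃ₗ[K] B) : Prop where
  map_slash : ∀ x y : A, φ (DuplicialAlgebra.slash (K := K) x y) =
    DuplicialAlgebra.slash (K := K) (φ x) (φ y)
  map_bslash : ∀ x y : A, φ (DuplicialAlgebra.bslash (K := K) x y) =
    DuplicialAlgebra.bslash (K := K) (φ x) (φ y)
  map_comul : ∀ x : A, DuplicialBialgebra.comul (K := K) (φ x) =
    TensorProduct.map φ.toLinearMap φ.toLinearMap (DuplicialBialgebra.comul (K := K) x)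

variable {A} in
/-- A two-sided ideal for both products. -/
def IsIdeal [DuplicialAlgebra K A] (I : Submodule K A) : Prop :=
  ∀ x ∈ I, ∀ y : A,
    DuplicialAlgebra.slash (K := K) x y ∈ I ∧ DuplicialAlgebra.slash (K := K) y x ∈ I ∧
    DuplicialAlgebra.bslash (K := K) x y ∈ I ∧ DuplicialAlgebra.bslash (K := K) y x ∈ I

variable {A} in
/-- The ideal spanned by a set: the smallest ideal containing it. -/
def idealSpan [DuplicialAlgebra K A] (S : Set A) : Submodule K A :=
  sInf {I : Submodule K A | IsIdeal K I ∧ S ⊆ I}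

end Basics

section Coassoc

variable {K : Type u} {A : Type v} [Field K] [AddCommGroup A] [Module K A]

/-- The elements on which `Δ` is coassociative are closed under a product that satisfies the
infinitesimal relation. -/
theorem coassoc_mul (m : A →ₗ[K] A →ₗ[K] A) (Δ : A →ₗ[K] A ⊗[K] A)
    (h : ∀ x y, Δ (m x y) = infinitesimalRHS m Δ x y) {x y : A}
    (hx : TensorProduct.assoc K A A A (Δ.rTensor A (Δ x)) = Δ.lTensor A (Δ x))
    (hy : TensorProduct.assoc K A A A (Δ.rTensor A (Δ y)) = Δ.lTensor A (Δ y)) :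
    TensorProduct.assoc K A A A (Δ.rTensor A (Δ (m x y))) = Δ.lTensor A (Δ (m x y)) := by
  -- the mixed term `∑ x₍₁₎ ⊗ (x₍₂₎ * y₍₁₎) ⊗ y₍₂₎`
  let mix : (A ⊗[K] A) →ₗ[K] (A ⊗[K] A) →ₗ[K] A ⊗[K] (A ⊗[K] A) :=
    TensorProduct.lift (LinearMap.mk₂ K
      (fun a b => (TensorProduct.mk K A (A ⊗[K] A) a) ∘ₗ ((m b).rTensor A))
      (fun _ _ _ => by ext; simp)
      (fun _ _ _ => by ext; simp)
      (fun _ _ _ => by ext; simp [TensorProduct.tmul_add])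
      (fun _ _ _ => by
        ext
        simp only [TensorProduct.AlgebraTensorModule.curry_apply, TensorProduct.curry_apply,
          LinearMap.coe_restrictScalars, LinearMap.comp_apply, LinearMap.rTensor_tmul, map_smul,
          LinearMap.smul_apply, TensorProduct.mk_apply]
        exact (congrArg _ (TensorProduct.smul_tmul' _ _ _).symm).trans
          (TensorProduct.tmul_smul _ _ _)))
  have e1 : ∀ z : A ⊗[K] A, TensorProduct.assoc K A A A
      (Δ.rTensor A ((m.flip y).lTensor A z)) =
      ((m.flip y).lTensor A).lTensor A (TensorProduct.assoc K A A A (Δ.rTensor A z)) := by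
    intro z
    induction z with
    | zero => simp
    | add a b ha hb => simp only [map_add, ha, hb]
    | tmul a b =>
      simp only [LinearMap.lTensor_tmul, LinearMap.rTensor_tmul]
      generalize Δ a = w
      induction w with
      | zero => simp
      | add a b ha hb => simp only [map_add, TensorProduct.add_tmul, ha, hb]
      | tmul c d => simp
  have e2 : ∀ z : A ⊗[K] A, TensorProduct.assoc K A A A (Δ.rTensor A ((m x).rTensor A z)) =
      mix (Δ x) z + (m x).rTensor (A ⊗[K] A) (TensorProduct.assoc K A A A (Δ.rTensor A z))
        + x ⊗ₜ z := by
    intro z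
    induction z with
    | zero => simp
    | add a b ha hb => simp only [map_add, ha, hb, TensorProduct.tmul_add]; abel
    | tmul a b =>
      simp only [LinearMap.rTensor_tmul, h, infinitesimalRHS, TensorProduct.add_tmul, map_add]
      congr 1
      congr 1
      · generalize Δ x = w
        induction w with
        | zero => simp
        | add a b ha hb =>
          simp only [map_add, TensorProduct.add_tmul, ha, hb, LinearMap.add_apply]
        | tmul c d => simp [mix]
      · generalize Δ a = w
        induction w with
        | zero => simp
        | add a b ha hb => simp only [map_add, TensorProduct.add_tmul, ha, hb]
        | tmul c d => simp
  have e3 : ∀ z : A ⊗[K] A, Δ.lTensor A ((m.flip y).lTensor A z) =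
      ((m.flip y).lTensor A).lTensor A (Δ.lTensor A z) + mix z (Δ y)
        + TensorProduct.assoc K A A A (z ⊗ₜ y) := by
    intro z
    induction z with
    | zero => simp
    | add a b ha hb =>
      simp only [map_add, ha, hb, TensorProduct.add_tmul, LinearMap.add_apply]; abel
    | tmul a b =>
      simp [h, infinitesimalRHS, TensorProduct.tmul_add, mix]
  have e4 : ∀ z : A ⊗[K] A, Δ.lTensor A ((m x).rTensor A z) =
      (m x).rTensor (A ⊗[K] A) (Δ.lTensor A z) := by
    intro z
    induction z with
    | zero => simp
    | add a b ha hb => simp only [map_add, ha, hb]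
    | tmul a b => simp
  rw [h]
  simp only [infinitesimalRHS, map_add, e1, e2, e3, e4, hx, hy, LinearMap.rTensor_tmul,
    LinearMap.lTensor_tmul]
  abel

end Coassoc

/-! ### The free duplicial algebra on coloured planar binary trees -/

/-- Grafting `t` on the leftmost leaf of `s`. -/
def treeSlash {E : Type w} (t : BinaryTree E) : BinaryTree E → BinaryTree E
  | .nil => t
  | .node e l r => .node e (treeSlash t l) r

/-- Grafting `s` on the rightmost leaf of `t`. -/
def treeBslash {E : Type w} (t s : BinaryTree E) : BinaryTree E :=
  match t with
  | .nil => s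
  | .node e l r => .node e l (treeBslash r s)

/-- Planar binary rooted trees with at least one internal vertex, internal vertices coloured by
`E`; the tree `|` without internal vertices is `BinaryTree.nil`. -/
abbrev ColoredTree (E : Type w) : Type w := {t : BinaryTree E // t ≠ .nil}

/-- The vector space `K[Y_∞, E]` of the free duplicial algebra on the set `E`. -/
def Dup (K : Type u) [Field K] (E : Type w) : Type (max u w) := ColoredTree E →₀ K

namespace Dup

variable {K : Type u} [Field K] {E : Type w}

noncomputable instance : AddCommGroup (Dup K E) := inferInstanceAs (AddCommGroup (_ →₀ K))

noncomputable instance : Module K (Dup K E) := inferInstanceAs (Module K (_ →₀ K))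

variable (K) in
/-- The basis element of a nonempty tree. -/
noncomputable def single (t : ColoredTree E) : Dup K E := Finsupp.single t (1 : K)

variable (K) in
/-- The basis element of a tree, with `|` sent to `0`. -/
noncomputable def ofTree : BinaryTree E → Dup K E
  | .nil => 0
  | .node e l r => single K ⟨.node e l r, by simp⟩

variable (K) in
/-- The generator attached to `e`: the tree with one vertex, coloured by `e`. -/
noncomputable def gen (e : E) : Dup K E := ofTree K (.node e .nil .nil)

/-- Linear extension of a function on nonempty trees. -/
noncomputable def extend {V : Type v} [AddCommGroup V] [Module K V] (f : BinaryTree E → V) :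
    Dup K E →ₗ[K] V :=
  Finsupp.linearCombination K (fun t : ColoredTree E => f t.1)

theorem ofTree_nil : ofTree K (.nil : BinaryTree E) = 0 := rfl

theorem single_eq (t : ColoredTree E) : single K t = ofTree K t.1 := by
  obtain ⟨t, ht⟩ := t
  cases t with
  | nil => exact absurd rfl ht
  | node e l r => rfl

theorem extend_ofTree {V : Type v} [AddCommGroup V] [Module K V] (f : BinaryTree E → V)
    {t : BinaryTree E} (ht : t ≠ .nil) : extend f (ofTree K t) = f t := by
  rw [← single_eq ⟨t, ht⟩]
  exact (Finsupp.linearCombination_single K 1 _).trans (one_smul K _)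

theorem hom_ext {V : Type v} [AddCommGroup V] [Module K V] {f g : Dup K E →ₗ[K] V}
    (h : ∀ t : BinaryTree E, t ≠ .nil → f (ofTree K t) = g (ofTree K t)) : f = g := by
  refine Finsupp.lhom_ext' fun t => LinearMap.ext_ring ?_
  have := h t.1 t.2
  rwa [← single_eq] at this

theorem induction_on {p : Dup K E → Prop} (x : Dup K E) (h0 : p 0)
    (hadd : ∀ x y, p x → p y → p (x + y)) (hsmul : ∀ (c : K) x, p x → p (c • x))
    (h : ∀ t : BinaryTree E, t ≠ .nil → p (ofTree K t)) : p x := by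
  refine Finsupp.induction_linear (motive := p) x h0 hadd fun t c => ?_
  have h1 : (Finsupp.single t c : ColoredTree E →₀ K) = c • Finsupp.single t (1 : K) := by simp
  rw [h1]
  refine hsmul c _ ?_
  have h2 := h t.1 t.2
  rwa [← single_eq] at h2

variable (K E) in
/-- The product `x / y` of `Dup(E)`. -/
noncomputable def slash : Dup K E →ₗ[K] Dup K E →ₗ[K] Dup K E :=
  extend fun t => extend fun s => ofTree K (treeSlash t s)

variable (K E) in
/-- The product `x \ y` of `Dup(E)`. -/
noncomputable def bslash : Dup K E →ₗ[K] Dup K E →ₗ[K] Dup K E :=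
  extend fun t => extend fun s => ofTree K (treeBslash t s)

variable (K) in
/-- The coproduct on trees: `Δ | = 0` and
`Δ (t ∨ w) = ∑ t₍₁₎ ⊗ (t₍₂₎ ∨ w) + t ⊗ (| ∨ w) + (t ∨ |) ⊗ w + ∑ (t ∨ w₍₁₎) ⊗ w₍₂₎`,
where a term that has the tree `|` as a tensor factor is omitted. -/
noncomputable def treeComul : BinaryTree E → Dup K E ⊗[K] Dup K E
  | .nil => 0
  | .node e t w =>
      (extend fun s => ofTree K (.node e s w)).lTensor (Dup K E) (treeComul t)
        + ofTree K t ⊗ₜ ofTree K (.node e .nil w)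
        + ofTree K (.node e t .nil) ⊗ₜ ofTree K w
        + (extend fun s => ofTree K (.node e t s)).rTensor (Dup K E) (treeComul w)

variable (K E) in
/-- The coproduct of `Dup(E)`. -/
noncomputable def comul : Dup K E →ₗ[K] Dup K E ⊗[K] Dup K E :=
  extend (treeComul K)

theorem treeSlash_ne {t s : BinaryTree E} (ht : t ≠ .nil) : treeSlash t s ≠ .nil := by
  cases s <;> simp [treeSlash, ht]

theorem treeBslash_ne {t s : BinaryTree E} (hs : s ≠ .nil) : treeBslash t s ≠ .nil := by
  cases t <;> simp [treeBslash, hs]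

theorem slash_ofTree {t s : BinaryTree E} (ht : t ≠ .nil) (hs : s ≠ .nil) :
    slash K E (ofTree K t) (ofTree K s) = ofTree K (treeSlash t s) := by
  rw [slash, extend_ofTree _ ht, extend_ofTree _ hs]

theorem bslash_ofTree {t s : BinaryTree E} (ht : t ≠ .nil) (hs : s ≠ .nil) :
    bslash K E (ofTree K t) (ofTree K s) = ofTree K (treeBslash t s) := by
  rw [bslash, extend_ofTree _ ht, extend_ofTree _ hs]

theorem comul_ofTree (t : BinaryTree E) : comul K E (ofTree K t) = treeComul K t := by
  cases t with
  | nil => simp [ofTree, treeComul]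
  | node e l r => exact extend_ofTree _ (by simp)

theorem treeSlash_treeSlash (t s r : BinaryTree E) :
    treeSlash t (treeSlash s r) = treeSlash (treeSlash t s) r := by
  induction r with
  | nil => rfl
  | node e a b iha ihb => simp [treeSlash, iha]

theorem treeBslash_treeBslash (t s r : BinaryTree E) :
    treeBslash t (treeBslash s r) = treeBslash (treeBslash t s) r := by
  induction t with
  | nil => rfl
  | node e a b iha ihb => simp [treeBslash, ihb]

theorem treeSlash_treeBslash (t : BinaryTree E) {s : BinaryTree E} (hs : s ≠ .nil)
    (r : BinaryTree E) : treeSlash t (treeBslash s r) = treeBslash (treeSlash t s) r := by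
  cases s with
  | nil => exact absurd rfl hs
  | node e a b => rfl

theorem treeComul_treeSlash {t s : BinaryTree E} (ht : t ≠ .nil) (hs : s ≠ .nil) :
    treeComul K (treeSlash t s) =
      infinitesimalRHS (slash K E) (comul K E) (ofTree K t) (ofTree K s) := by
  induction s with
  | nil => exact absurd rfl hs
  | node e l r ihl ihr =>
    rw [infinitesimalRHS, comul_ofTree, comul_ofTree]
    have h4 : (extend fun s => ofTree K (.node e (treeSlash t l) s)) =
        (slash K E (ofTree K t)) ∘ₗ (extend fun s => ofTree K (.node e l s)) := by
      refine hom_ext fun q hq => ?_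
      rw [LinearMap.comp_apply, extend_ofTree _ hq, extend_ofTree _ hq,
        slash_ofTree ht (by simp)]
      rfl
    have h3 : ofTree K (.node e (treeSlash t l) .nil) =
        slash K E (ofTree K t) (ofTree K (.node e l .nil)) := by
      rw [slash_ofTree ht (by simp)]; rfl
    by_cases hl : l = .nil
    · subst hl
      have h1 : (extend fun s => ofTree K (.node e s r)) =
          (slash K E).flip (ofTree K (.node e .nil r)) := by
        refine hom_ext fun q hq => ?_
        rw [extend_ofTree _ hq, LinearMap.flip_apply, slash_ofTree hq (by simp)]
        rfl
      simp only [treeSlash] at h3 h4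
      simp only [treeSlash, treeComul, h4, h3, h1, map_add, LinearMap.rTensor_tmul, map_zero,
        ofTree_nil, TensorProduct.zero_tmul, LinearMap.rTensor_comp_apply]
      abel
    · have h1 : (extend fun s => ofTree K (.node e s r)) ∘ₗ (slash K E).flip (ofTree K l) =
          (slash K E).flip (ofTree K (.node e l r)) := by
        refine hom_ext fun q hq => ?_
        rw [LinearMap.comp_apply, LinearMap.flip_apply, LinearMap.flip_apply,
          slash_ofTree hq hl, slash_ofTree hq (by simp), extend_ofTree _ (treeSlash_ne hq)]
        rfl
      have h5 : (extend fun s => ofTree K (.node e s r)) (ofTree K l) =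
          ofTree K (.node e l r) := extend_ofTree _ hl
      simp only [treeSlash, treeComul, h4, h3, ihl hl, infinitesimalRHS, comul_ofTree, map_add,
        LinearMap.rTensor_comp_apply, ← LinearMap.lTensor_comp_apply, h1, LinearMap.lTensor_tmul,
        h5, LinearMap.rTensor_tmul, slash_ofTree ht hl]
      have h6 : ∀ (f g : Dup K E →ₗ[K] Dup K E) (z : Dup K E ⊗[K] Dup K E),
          f.lTensor (Dup K E) (g.rTensor (Dup K E) z) =
            g.rTensor (Dup K E) (f.lTensor (Dup K E) z) := by
        intro f g z
        rw [← LinearMap.comp_apply, ← LinearMap.comp_apply, LinearMap.lTensor_comp_rTensor,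
          LinearMap.rTensor_comp_lTensor]
      rw [h6]
      abel

theorem treeComul_treeBslash {t s : BinaryTree E} (ht : t ≠ .nil) (hs : s ≠ .nil) :
    treeComul K (treeBslash t s) =
      infinitesimalRHS (bslash K E) (comul K E) (ofTree K t) (ofTree K s) := by
  induction t with
  | nil => exact absurd rfl ht
  | node e l r ihl ihr =>
    rw [infinitesimalRHS, comul_ofTree, comul_ofTree]
    have h4 : (extend fun q => ofTree K (.node e q (treeBslash r s))) =
        ((bslash K E).flip (ofTree K s)) ∘ₗ (extend fun q => ofTree K (.node e q r)) := by
      refine hom_ext fun q hq => ?_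
      rw [LinearMap.comp_apply, extend_ofTree _ hq, extend_ofTree _ hq, LinearMap.flip_apply,
        bslash_ofTree (by simp) hs]
      rfl
    have h3 : ofTree K (.node e .nil (treeBslash r s)) =
        (bslash K E).flip (ofTree K s) (ofTree K (.node e .nil r)) := by
      rw [LinearMap.flip_apply, bslash_ofTree (by simp) hs]; rfl
    by_cases hr : r = .nil
    · subst hr
      have h1 : (extend fun q => ofTree K (.node e l q)) =
          (bslash K E) (ofTree K (.node e l .nil)) := by
        refine hom_ext fun q hq => ?_
        rw [extend_ofTree _ hq, bslash_ofTree (by simp) hq]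
        rfl
      simp only [treeBslash] at h3 h4
      simp only [treeBslash, treeComul, h4, h3, h1, map_add, LinearMap.lTensor_tmul, map_zero,
        ofTree_nil, TensorProduct.tmul_zero, LinearMap.lTensor_comp_apply]
      abel
    · have h1 : (extend fun q => ofTree K (.node e l q)) ∘ₗ (bslash K E) (ofTree K r) =
          (bslash K E) (ofTree K (.node e l r)) := by
        refine hom_ext fun q hq => ?_
        rw [LinearMap.comp_apply, bslash_ofTree hr hq, bslash_ofTree (by simp) hq,
          extend_ofTree _ (treeBslash_ne hq)]
        rfl
      have h5 : (extend fun q => ofTree K (.node e l q)) (ofTree K r) =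
          ofTree K (.node e l r) := extend_ofTree _ hr
      simp only [treeBslash, treeComul, h4, h3, ihr hr, infinitesimalRHS, comul_ofTree, map_add,
        LinearMap.lTensor_comp_apply, ← LinearMap.rTensor_comp_apply, h1, LinearMap.rTensor_tmul,
        h5, LinearMap.lTensor_tmul]
      rw [LinearMap.flip_apply (bslash K E) (ofTree K r), bslash_ofTree hr hs]
      have h6 : ∀ (f g : Dup K E →ₗ[K] Dup K E) (z : Dup K E ⊗[K] Dup K E),
          g.rTensor (Dup K E) (f.lTensor (Dup K E) z) =
            f.lTensor (Dup K E) (g.rTensor (Dup K E) z) := by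
        intro f g z
        rw [← LinearMap.comp_apply, ← LinearMap.comp_apply, LinearMap.lTensor_comp_rTensor,
          LinearMap.rTensor_comp_lTensor]
      rw [h6]
      abel

variable (K) in
theorem ofTree_left (e : E) {l : BinaryTree E} (hl : l ≠ .nil) :
    ofTree K (.node e l .nil) = slash K E (ofTree K l) (gen K e) := by
  rw [gen, slash_ofTree hl (by simp)]; rfl

variable (K) in
theorem ofTree_right (e : E) (l : BinaryTree E) {r : BinaryTree E} (hr : r ≠ .nil) :
    ofTree K (.node e l r) = bslash K E (ofTree K (.node e l .nil)) (ofTree K r) := by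
  rw [bslash_ofTree (by simp) hr]; rfl

theorem comul_gen (e : E) : comul K E (gen K e) = 0 := by
  simp [gen, comul_ofTree, treeComul, ofTree_nil]

theorem comul_slash (x y : Dup K E) :
    comul K E (slash K E x y) = infinitesimalRHS (slash K E) (comul K E) x y := by
  induction x using induction_on with
  | h0 => simp [infinitesimalRHS]
  | hadd a b ha hb =>
    simp only [map_add, LinearMap.add_apply, ha, hb, infinitesimalRHS,
      LinearMap.rTensor_add, TensorProduct.add_tmul]
    abel
  | hsmul c a ha =>
    simp only [map_smul, LinearMap.smul_apply, ha, infinitesimalRHS, LinearMap.rTensor_smul,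
      ← TensorProduct.smul_tmul', smul_add]
  | h t ht =>
    induction y using induction_on with
    | h0 => simp [infinitesimalRHS]
    | hadd a b ha hb =>
      simp only [map_add, LinearMap.add_apply, ha, hb, infinitesimalRHS, LinearMap.lTensor_add,
        TensorProduct.tmul_add]
      abel
    | hsmul c a ha =>
      simp only [map_smul, LinearMap.smul_apply, ha, infinitesimalRHS, LinearMap.lTensor_smul,
        TensorProduct.tmul_smul, smul_add]
    | h s hs => rw [slash_ofTree ht hs, comul_ofTree, treeComul_treeSlash ht hs]

theorem comul_bslash (x y : Dup K E) :
    comul K E (bslash K E x y) = infinitesimalRHS (bslash K E) (comul K E) x y := by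
  induction x using induction_on with
  | h0 => simp [infinitesimalRHS]
  | hadd a b ha hb =>
    simp only [map_add, LinearMap.add_apply, ha, hb, infinitesimalRHS,
      LinearMap.rTensor_add, TensorProduct.add_tmul]
    abel
  | hsmul c a ha =>
    simp only [map_smul, LinearMap.smul_apply, ha, infinitesimalRHS, LinearMap.rTensor_smul,
      ← TensorProduct.smul_tmul', smul_add]
  | h t ht =>
    induction y using induction_on with
    | h0 => simp [infinitesimalRHS]
    | hadd a b ha hb =>
      simp only [map_add, LinearMap.add_apply, ha, hb, infinitesimalRHS, LinearMap.lTensor_add,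
        TensorProduct.tmul_add]
      abel
    | hsmul c a ha =>
      simp only [map_smul, LinearMap.smul_apply, ha, infinitesimalRHS, LinearMap.lTensor_smul,
        TensorProduct.tmul_smul, smul_add]
    | h s hs => rw [bslash_ofTree ht hs, comul_ofTree, treeComul_treeBslash ht hs]

theorem coassoc_ofTree (t : BinaryTree E) :
    TensorProduct.assoc K _ _ _ ((comul K E).rTensor (Dup K E) (comul K E (ofTree K t))) =
      (comul K E).lTensor (Dup K E) (comul K E (ofTree K t)) := by
  induction t with
  | nil => simp [ofTree_nil]
  | node e l r ihl ihr =>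
    have hl : TensorProduct.assoc K _ _ _
        ((comul K E).rTensor (Dup K E) (comul K E (ofTree K (.node e l .nil)))) =
        (comul K E).lTensor (Dup K E) (comul K E (ofTree K (.node e l .nil))) := by
      by_cases h : l = .nil
      · subst h
        have := comul_gen (K := K) e
        rw [gen] at this
        simp [this]
      · rw [ofTree_left K e h]
        exact coassoc_mul _ _ comul_slash ihl (by simp [comul_gen])
    by_cases h : r = .nil
    · subst h; exact hl
    · rw [ofTree_right K e l h]
      exact coassoc_mul _ _ comul_bslash hl ihr

/-- The free duplicial algebra on `E`, with its duplicial bialgebra structure. -/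
noncomputable instance : DuplicialBialgebra K (Dup K E) where
  slash := slash K E
  bslash := bslash K E
  comul := comul K E
  slash_slash x y z := by
    induction x using induction_on with
    | h0 => simp
    | hadd a b ha hb => simp only [map_add, LinearMap.add_apply, ha, hb]
    | hsmul c a ha => simp only [map_smul, LinearMap.smul_apply, ha]
    | h t ht =>
    induction y using induction_on with
    | h0 => simp
    | hadd a b ha hb => simp only [map_add, LinearMap.add_apply, ha, hb]
    | hsmul c a ha => simp only [map_smul, LinearMap.smul_apply, ha]
    | h s hs =>
    induction z using induction_on with
    | h0 => simp
    | hadd a b ha hb => simp only [map_add, ha, hb]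
    | hsmul c a ha => simp only [map_smul, ha]
    | h r hr =>
      rw [slash_ofTree hs hr, slash_ofTree ht hs, slash_ofTree ht (treeSlash_ne hs),
        slash_ofTree (treeSlash_ne ht) hr, treeSlash_treeSlash]
  slash_bslash x y z := by
    induction x using induction_on with
    | h0 => simp
    | hadd a b ha hb => simp only [map_add, LinearMap.add_apply, ha, hb]
    | hsmul c a ha => simp only [map_smul, LinearMap.smul_apply, ha]
    | h t ht =>
    induction y using induction_on with
    | h0 => simp
    | hadd a b ha hb => simp only [map_add, LinearMap.add_apply, ha, hb]
    | hsmul c a ha => simp only [map_smul, LinearMap.smul_apply, ha]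
    | h s hs =>
    induction z using induction_on with
    | h0 => simp
    | hadd a b ha hb => simp only [map_add, ha, hb]
    | hsmul c a ha => simp only [map_smul, ha]
    | h r hr =>
      rw [bslash_ofTree hs hr, slash_ofTree ht hs, slash_ofTree ht (treeBslash_ne hr),
        bslash_ofTree (treeSlash_ne ht) hr, treeSlash_treeBslash _ hs]
  bslash_bslash x y z := by
    induction x using induction_on with
    | h0 => simp
    | hadd a b ha hb => simp only [map_add, LinearMap.add_apply, ha, hb]
    | hsmul c a ha => simp only [map_smul, LinearMap.smul_apply, ha]
    | h t ht =>
    induction y using induction_on with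
    | h0 => simp
    | hadd a b ha hb => simp only [map_add, LinearMap.add_apply, ha, hb]
    | hsmul c a ha => simp only [map_smul, LinearMap.smul_apply, ha]
    | h s hs =>
    induction z using induction_on with
    | h0 => simp
    | hadd a b ha hb => simp only [map_add, ha, hb]
    | hsmul c a ha => simp only [map_smul, ha]
    | h r hr =>
      rw [bslash_ofTree hs hr, bslash_ofTree ht hs, bslash_ofTree ht (treeBslash_ne hr),
        bslash_ofTree (treeBslash_ne hs) hr, treeBslash_treeBslash]
  coassoc x := by
    induction x using induction_on with
    | h0 => simp
    | hadd a b ha hb => simp only [map_add, ha, hb]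
    | hsmul c a ha => simp only [map_smul, ha]
    | h t ht => exact coassoc_ofTree t
  comul_slash := comul_slash
  comul_bslash := comul_bslash

theorem gen_mem_prim (e : E) : gen K e ∈ Prim K (Dup K E) := comul_gen e

variable (K) in
/-- The generator attached to `e`, as a primitive element. -/
noncomputable def primGen (e : E) : Prim K (Dup K E) := ⟨gen K e, gen_mem_prim e⟩

end Dup

/-! ### Quotients -/

section Quotient

variable {K : Type u} {A : Type v} [Field K] [AddCommGroup A] [Module K A]

/-- The bilinear map induced on a quotient. -/
def quotientMul (I : Submodule K A) (m : A →ₗ[K] A →ₗ[K] A)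
    (hl : ∀ x ∈ I, ∀ y, m x y ∈ I) (hr : ∀ x ∈ I, ∀ y, m y x ∈ I) :
    A ⧸ I →ₗ[K] A ⧸ I →ₗ[K] A ⧸ I :=
  (I.liftQ (I.liftQ (m.compr₂ I.mkQ)
    (fun x hx => by ext y; simpa using hl x hx y)).flip
    (fun x hx => by
      ext y
      change I.mkQ (m y x) = 0
      simpa using hr x hx y)).flip

theorem quotientMul_mk (I : Submodule K A) (m : A →ₗ[K] A →ₗ[K] A)
    (hl : ∀ x ∈ I, ∀ y, m x y ∈ I) (hr : ∀ x ∈ I, ∀ y, m y x ∈ I) (x y : A) :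
    quotientMul I m hl hr (I.mkQ x) (I.mkQ y) = I.mkQ (m x y) := rfl

/-- The coproduct induced on a quotient. -/
noncomputable def quotientComul (I : Submodule K A) (Δ : A →ₗ[K] A ⊗[K] A)
    (h : ∀ x ∈ I, TensorProduct.map I.mkQ I.mkQ (Δ x) = 0) :
    A ⧸ I →ₗ[K] (A ⧸ I) ⊗[K] (A ⧸ I) :=
  I.liftQ (TensorProduct.map I.mkQ I.mkQ ∘ₗ Δ) (fun x hx => h x hx)

theorem quotientComul_mk (I : Submodule K A) (Δ : A →ₗ[K] A ⊗[K] A)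
    (h : ∀ x ∈ I, TensorProduct.map I.mkQ I.mkQ (Δ x) = 0) (x : A) :
    quotientComul I Δ h (I.mkQ x) = TensorProduct.map I.mkQ I.mkQ (Δ x) := rfl

theorem map_infinitesimalRHS {B : Type w} [AddCommGroup B] [Module K B] (f : A →ₗ[K] B)
    {m : A →ₗ[K] A →ₗ[K] A} {Δ : A →ₗ[K] A ⊗[K] A} {m' : B →ₗ[K] B →ₗ[K] B}
    (hm : ∀ x y, m' (f x) (f y) = f (m x y)) (x y : A) :
    TensorProduct.map f f (infinitesimalRHS m Δ x y) =
      (m'.flip (f y)).lTensor B (TensorProduct.map f f (Δ x)) +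
        (m' (f x)).rTensor B (TensorProduct.map f f (Δ y)) + f x ⊗ₜ f y := by
  rw [infinitesimalRHS, map_add, map_add, TensorProduct.map_tmul]
  congr 2
  · generalize Δ x = w
    induction w with
    | zero => simp
    | add a b ha hb => simp only [map_add, ha, hb]
    | tmul a b => simp [hm]
  · generalize Δ y = w
    induction w with
    | zero => simp
    | add a b ha hb => simp only [map_add, ha, hb]
    | tmul a b => simp [hm]

theorem idealSpan_isIdeal [DuplicialAlgebra K A] (S : Set A) : IsIdeal K (idealSpan K S) := by
  intro x hx y
  simp only [idealSpan, Submodule.mem_sInf, Set.mem_ofPred_eq] at hx ⊢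
  exact ⟨fun I hI => (hI.1 x (hx I hI) y).1, fun I hI => (hI.1 x (hx I hI) y).2.1,
    fun I hI => (hI.1 x (hx I hI) y).2.2.1, fun I hI => (hI.1 x (hx I hI) y).2.2.2⟩

theorem idealSpan_le [DuplicialAlgebra K A] {S : Set A} {I : Submodule K A}
    (hI : IsIdeal K I) (hS : S ⊆ I) : idealSpan K S ≤ I := sInf_le ⟨hI, hS⟩

/-- An ideal spanned by primitive elements is a coideal. -/
theorem idealSpan_coideal [DuplicialBialgebra K A] {S : Set A} (hS : S ⊆ Prim K A) :
    ∀ x ∈ idealSpan K S, TensorProduct.map (idealSpan K S).mkQ (idealSpan K S).mkQ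
      (DuplicialBialgebra.comul (K := K) x) = 0 := by
  have hid := idealSpan_isIdeal (K := K) S
  set I := idealSpan K S with hI
  have hs : ∀ x y : A, quotientMul I DuplicialAlgebra.slash (fun x hx y => (hid x hx y).1)
      (fun x hx y => (hid x hx y).2.1) (I.mkQ x) (I.mkQ y) =
      I.mkQ (DuplicialAlgebra.slash (K := K) x y) := fun _ _ => rfl
  have hb : ∀ x y : A, quotientMul I DuplicialAlgebra.bslash (fun x hx y => (hid x hx y).2.2.1)
      (fun x hx y => (hid x hx y).2.2.2) (I.mkQ x) (I.mkQ y) =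
      I.mkQ (DuplicialAlgebra.bslash (K := K) x y) := fun _ _ => rfl
  have hle : I ≤ I ⊓ LinearMap.ker (TensorProduct.map I.mkQ I.mkQ ∘ₗ
      DuplicialBialgebra.comul (K := K)) := by
    conv_lhs => rw [hI]
    refine idealSpan_le ?_ ?_
    · rintro x ⟨hx, hx'⟩ y
      have hx0 : I.mkQ x = 0 := by simpa using hx
      simp only [SetLike.mem_coe, LinearMap.mem_ker, LinearMap.comp_apply] at hx'
      refine ⟨⟨(hid x hx y).1, ?_⟩, ⟨(hid x hx y).2.1, ?_⟩, ⟨(hid x hx y).2.2.1, ?_⟩,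
        ⟨(hid x hx y).2.2.2, ?_⟩⟩
      · simp only [SetLike.mem_coe, LinearMap.mem_ker, LinearMap.comp_apply,
          DuplicialBialgebra.comul_slash, map_infinitesimalRHS I.mkQ hs, hx', hx0]
        simp
      · simp only [SetLike.mem_coe, LinearMap.mem_ker, LinearMap.comp_apply,
          DuplicialBialgebra.comul_slash, map_infinitesimalRHS I.mkQ hs, hx', hx0]
        simp
      · simp only [SetLike.mem_coe, LinearMap.mem_ker, LinearMap.comp_apply,
          DuplicialBialgebra.comul_bslash, map_infinitesimalRHS I.mkQ hb, hx', hx0]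
        simp
      · simp only [SetLike.mem_coe, LinearMap.mem_ker, LinearMap.comp_apply,
          DuplicialBialgebra.comul_bslash, map_infinitesimalRHS I.mkQ hb, hx', hx0]
        simp
    · intro x hx
      refine ⟨?_, ?_⟩
      · simp only [hI, idealSpan, SetLike.mem_coe, Submodule.mem_sInf]
        exact fun J hJ => hJ.2 hx
      · have := hS hx
        simp only [Prim, SetLike.mem_coe, LinearMap.mem_ker] at this
        simp [this]
  intro x hx
  exact (hle hx).2

/-- The quotient of a duplicial bialgebra by an ideal that is a coideal. -/
@[reducible]
noncomputable def quotientBialgebra [DuplicialBialgebra K A] (I : Submodule K A)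
    (hid : IsIdeal K I)
    (hco : ∀ x ∈ I, TensorProduct.map I.mkQ I.mkQ (DuplicialBialgebra.comul (K := K) x) = 0) :
    DuplicialBialgebra K (A ⧸ I) where
  slash := quotientMul I DuplicialAlgebra.slash (fun x hx y => (hid x hx y).1)
    (fun x hx y => (hid x hx y).2.1)
  bslash := quotientMul I DuplicialAlgebra.bslash (fun x hx y => (hid x hx y).2.2.1)
    (fun x hx y => (hid x hx y).2.2.2)
  comul := quotientComul I DuplicialBialgebra.comul hco
  slash_slash x y z := by
    obtain ⟨x, rfl⟩ := I.mkQ_surjective x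
    obtain ⟨y, rfl⟩ := I.mkQ_surjective y
    obtain ⟨z, rfl⟩ := I.mkQ_surjective z
    simp only [quotientMul_mk, DuplicialAlgebra.slash_slash]
  slash_bslash x y z := by
    obtain ⟨x, rfl⟩ := I.mkQ_surjective x
    obtain ⟨y, rfl⟩ := I.mkQ_surjective y
    obtain ⟨z, rfl⟩ := I.mkQ_surjective z
    simp only [quotientMul_mk, DuplicialAlgebra.slash_bslash]
  bslash_bslash x y z := by
    obtain ⟨x, rfl⟩ := I.mkQ_surjective x
    obtain ⟨y, rfl⟩ := I.mkQ_surjective y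
    obtain ⟨z, rfl⟩ := I.mkQ_surjective z
    simp only [quotientMul_mk, DuplicialAlgebra.bslash_bslash]
  coassoc x := by
    obtain ⟨x, rfl⟩ := I.mkQ_surjective x
    have e1 : ∀ z : A ⊗[K] A, TensorProduct.assoc K _ _ _
        ((quotientComul I DuplicialBialgebra.comul hco).rTensor (A ⧸ I)
          (TensorProduct.map I.mkQ I.mkQ z)) =
        TensorProduct.map I.mkQ (TensorProduct.map I.mkQ I.mkQ)
          (TensorProduct.assoc K _ _ _ ((DuplicialBialgebra.comul (K := K)).rTensor A z)) := by
      intro z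
      induction z with
      | zero => simp
      | add a b ha hb => simp only [map_add, ha, hb]
      | tmul a b =>
        simp only [TensorProduct.map_tmul, LinearMap.rTensor_tmul, quotientComul_mk]
        generalize DuplicialBialgebra.comul (K := K) a = w
        induction w with
        | zero => simp
        | add a b ha hb => simp only [map_add, TensorProduct.add_tmul, ha, hb]
        | tmul c d => simp
    have e2 : ∀ z : A ⊗[K] A,
        (quotientComul I DuplicialBialgebra.comul hco).lTensor (A ⧸ I)
          (TensorProduct.map I.mkQ I.mkQ z) =
        TensorProduct.map I.mkQ (TensorProduct.map I.mkQ I.mkQ)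
          ((DuplicialBialgebra.comul (K := K)).lTensor A z) := by
      intro z
      induction z with
      | zero => simp
      | add a b ha hb => simp only [map_add, ha, hb]
      | tmul a b =>
        simp only [TensorProduct.map_tmul, LinearMap.lTensor_tmul, quotientComul_mk]
    rw [quotientComul_mk, e1, e2, DuplicialBialgebra.coassoc]
  comul_slash x y := by
    obtain ⟨x, rfl⟩ := I.mkQ_surjective x
    obtain ⟨y, rfl⟩ := I.mkQ_surjective y
    rw [quotientMul_mk, quotientComul_mk, DuplicialBialgebra.comul_slash,
      map_infinitesimalRHS I.mkQ (quotientMul_mk I _ _ _)]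
    rfl
  comul_bslash x y := by
    obtain ⟨x, rfl⟩ := I.mkQ_surjective x
    obtain ⟨y, rfl⟩ := I.mkQ_surjective y
    rw [quotientMul_mk, quotientComul_mk, DuplicialBialgebra.comul_bslash,
      map_infinitesimalRHS I.mkQ (quotientMul_mk I _ _ _)]
    rfl

end Quotient

/-! ### The universal duplicial enveloping algebra of a magmatic algebra

A magmatic algebra is a vector space `M` with a bilinear map `μ : M →ₗ[K] M →ₗ[K] M`. -/

section Enveloping

variable {K : Type u} [Field K] {M : Type v} [AddCommGroup M] [Module K M] {ι : Type w}

/-- The inclusion of `M` in the free duplicial algebra on a basis of `M`, which sends the basis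
vector `b i` to the generator attached to `i`. -/
noncomputable def inclusion (b : Module.Basis ι K M) : M →ₗ[K] Dup K ι :=
  b.constr K (Dup.gen K)

theorem inclusion_mem_prim (b : Module.Basis ι K M) (x : M) :
    inclusion b x ∈ Prim K (Dup K ι) := by
  rw [inclusion, Module.Basis.constr_apply]
  exact Submodule.sum_mem _ fun i _ => Submodule.smul_mem _ _ (Dup.gen_mem_prim i)

/-- The elements `{x, y} - x · y` of the free duplicial algebra, for `x, y ∈ M`. -/
def relations (μ : M →ₗ[K] M →ₗ[K] M) (b : Module.Basis ι K M) : Set (Dup K ι) :=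
  {z | ∃ x y : M, z = bracket K (inclusion b x) (inclusion b y) - inclusion b (μ x y)}

/-- The universal duplicial enveloping algebra of the magmatic algebra `(M, μ)`: the quotient of
the free duplicial algebra over the vector space `M`, realised on a basis `b` of `M`, by the ideal
spanned by the elements `{x, y} - x · y`. -/
def UDup (μ : M →ₗ[K] M →ₗ[K] M) (b : Module.Basis ι K M) : Type (max u w) :=
  Dup K ι ⧸ idealSpan K (relations μ b)

variable (μ : M →ₗ[K] M →ₗ[K] M) (b : Module.Basis ι K M)

theorem relations_subset_prim : relations μ b ⊆ Prim K (Dup K ι) := by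
  rintro _ ⟨x, y, rfl⟩
  exact Submodule.sub_mem _
    (bracket_mem_prim K (inclusion_mem_prim b x) (inclusion_mem_prim b y))
    (inclusion_mem_prim b _)

noncomputable instance : AddCommGroup (UDup μ b) :=
  inferInstanceAs (AddCommGroup (Dup K ι ⧸ idealSpan K (relations μ b)))

noncomputable instance : Module K (UDup μ b) :=
  inferInstanceAs (Module K (Dup K ι ⧸ idealSpan K (relations μ b)))

/-- The duplicial bialgebra structure induced by that of the free duplicial algebra. -/
noncomputable instance : DuplicialBialgebra K (UDup μ b) :=
  quotientBialgebra (idealSpan K (relations μ b)) (idealSpan_isIdeal _)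
    (idealSpan_coideal (relations_subset_prim μ b))

/-- The canonical map from `M` to its enveloping algebra. -/
noncomputable def UDup.of : M →ₗ[K] UDup μ b :=
  (idealSpan K (relations μ b)).mkQ ∘ₗ inclusion b

end Enveloping

end Duplicial

/-! The two identities `{x, y\z} = {x, y}\z` and `(x\y)/z = x/(y/z) + {x, y}/z` trade the product
`/` for the bracket. Hence, if a subspace `V` generates a duplicial algebra and is closed under the
bracket, the iterated products `v₁\(v₂\⋯\vₙ)` already span it (`Generates.leftGenerates`).

For primitive `v`, the coproduct is `Δ(v\x) = ∑ (v\x₍₁₎) ⊗ x₍₂₎ + v ⊗ x`, as for deconcatenation of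
words. So a bialgebra spanned by such products of primitive elements is connected. On a connected
bialgebra the recursion `e(x) = x - ∑ e(x₍₁₎)\x₍₂₎` has a solution `e`, which is the identity on
primitive elements, has primitive values and kills every product `x\y`. This gives two facts: a left
generating subspace of primitive elements contains all of them (`LeftGenerates.prim_le`), and a
connected bialgebra is left generated by its primitive elements (`IsConnected.leftGenerates`).

In `UDup μ b` the image of `M` is primitive, generating and, by the relations, closed under the
bracket; it is therefore exactly the primitive part. Injectivity of `M → UDup μ b` needs a model:
nonempty tensor words in `M`, with concatenation as `\` and a product `/` defined recursively so
that letters satisfy `{p, q} = p · q`. This gives (b).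

For (a), the inclusion of `Prim A` extends to a bialgebra map from the enveloping algebra to `A`. It
is injective because it is injective on primitive elements and its source is connected, and
surjective because `A` is left generated by `Prim A`. For (c), the same left generation argument
shows that brackets of the generators span the primitive part of `Dup K E`, whence uniqueness;
existence comes from mapping `Dup K E` to the enveloping algebra of `N`, whose primitive part is
`N`. -/

namespace Duplicial

/-! ### Generation by `\` alone, and homomorphisms -/

section Generation

variable {K : Type u} {A : Type v} [Field K] [AddCommGroup A] [Module K A]

local notation "sl" => DuplicialAlgebra.slash (K := K)
local notation "bs" => DuplicialAlgebra.bslash (K := K)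

/-- A subspace generates a duplicial algebra when the only subspace that contains it and is closed
under both products is the whole algebra. -/
def Generates [DuplicialAlgebra K A] (V : Submodule K A) : Prop :=
  ∀ S : Submodule K A, V ≤ S → (∀ x ∈ S, ∀ y ∈ S, sl x y ∈ S) →
    (∀ x ∈ S, ∀ y ∈ S, bs x y ∈ S) → S = ⊤

/-- A subspace left generates a duplicial algebra when the iterated products
`v₁ \ (v₂ \ ⋯ \ vₙ)` of its elements span the algebra. -/
def LeftGenerates [DuplicialAlgebra K A] (V : Submodule K A) : Prop :=
  ∀ S : Submodule K A, V ≤ S → (∀ x ∈ V, ∀ y ∈ S, bs x y ∈ S) → S = ⊤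

theorem bracket_apply [DuplicialAlgebra K A] (x y : A) :
    bracket K x y = bs x y - sl x y := rfl

/-- Both `x\(y\z)` and `x/(y\z)` reassociate to the left, so bracketing with `x` affects only the
first factor of a `\`-product. -/
theorem bracket_bslash [DuplicialAlgebra K A] (x y z : A) :
    bracket K x (bs y z) = bs (bracket K x y) z := by
  simp only [bracket_apply, map_sub, LinearMap.sub_apply, DuplicialAlgebra.bslash_bslash,
    DuplicialAlgebra.slash_bslash]

/-- Although `(x\y)/z` does not reassociate, replacing `x\y` by `x/y + {x, y}` does. This reduces
`/` by a `\`-product to `/` by its factors, up to a bracket. -/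
theorem bslash_slash [DuplicialAlgebra K A] (x y z : A) :
    sl (bs x y) z = sl x (sl y z) + sl (bracket K x y) z := by
  simp only [bracket_apply, map_sub, LinearMap.sub_apply, DuplicialAlgebra.slash_slash]
  abel

/-- A generating subspace that is closed under the bracket left generates. -/
theorem Generates.leftGenerates [DuplicialAlgebra K A] {V : Submodule K A} (hV : Generates V)
    (hbr : ∀ x ∈ V, ∀ y ∈ V, bracket K x y ∈ V) : LeftGenerates V := by
  intro S' hVS' hS'
  -- With `S` the least subspace of this kind, `hle` serves as induction over the products
  -- `v₁\(⋯\vₙ)`. It remains to show that `S` is closed under both products.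
  let C : Set (Submodule K A) := {S | V ≤ S ∧ ∀ x ∈ V, ∀ y ∈ S, bs x y ∈ S}
  let S : Submodule K A := sInf C
  have hle : ∀ T ∈ C, S ≤ T := fun T hT => sInf_le hT
  have hVS : V ≤ S := le_sInf fun T hT => hT.1
  have hS : ∀ x ∈ V, ∀ y ∈ S, bs x y ∈ S := fun x hx y hy =>
    Submodule.mem_sInf.2 fun T hT => hT.2 x hx y (hle T hT hy)
  have hb : ∀ x ∈ S, ∀ y ∈ S, bs x y ∈ S := by
    let T : Submodule K A :=
      { carrier := {x | ∀ y ∈ S, bs x y ∈ S}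
        zero_mem' := fun y _ => by simp
        add_mem' := fun {a b} ha hb y hy => by
          rw [map_add, LinearMap.add_apply]; exact add_mem (ha y hy) (hb y hy)
        smul_mem' := fun c a ha y hy => by
          rw [map_smul, LinearMap.smul_apply]; exact S.smul_mem c (ha y hy) }
    refine hle T ⟨fun x hx y hy => hS x hx y hy, fun x hx y hy z hz => ?_⟩
    rw [← DuplicialAlgebra.bslash_bslash]
    exact hS x hx _ (hy z hz)
  have hD : ∀ x ∈ S, ∀ v ∈ V, bracket K v x ∈ S := by
    let T : Submodule K A :=
      { carrier := {x | x ∈ S ∧ ∀ v ∈ V, bracket K v x ∈ S}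
        zero_mem' := ⟨zero_mem _, fun y _ => by simp⟩
        add_mem' := fun {a b} ha hb => ⟨add_mem ha.1 hb.1, fun y hy => by
          rw [map_add]; exact add_mem (ha.2 y hy) (hb.2 y hy)⟩
        smul_mem' := fun c a ha => ⟨S.smul_mem c ha.1, fun y hy => by
          rw [map_smul]; exact S.smul_mem c (ha.2 y hy)⟩ }
    intro x hx
    refine (hle T ⟨fun x hx => ⟨hVS hx, fun v hv => hVS (hbr v hv x hx)⟩,
      fun x hx y hy => ⟨hS x hx y hy.1, fun v hv => ?_⟩⟩ hx).2
    rw [bracket_bslash]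
    exact hS _ (hbr v hv x hx) y hy.1
  -- Here `/` by an element of `V` is eliminated through `v/x = v\x - {v, x}`.
  have hL : ∀ v ∈ V, ∀ x ∈ S, sl v x ∈ S := by
    intro v hv x hx
    have : sl v x = bs v x - bracket K v x := by rw [bracket_apply]; abel
    rw [this]
    exact sub_mem (hS v hv x hx) (hD x hx v hv)
  let Q : Submodule K A :=
    { carrier := {x | ∀ y ∈ S, sl x y ∈ S}
      zero_mem' := fun y _ => by simp
      add_mem' := fun {a b} ha hb y hy => by
        rw [map_add, LinearMap.add_apply]; exact add_mem (ha y hy) (hb y hy)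
      smul_mem' := fun c a ha y hy => by
        rw [map_smul, LinearMap.smul_apply]; exact S.smul_mem c (ha y hy) }
  -- The induction hypothesis must also cover `{v, x}`, which appears when `(v\x)/y` is expanded.
  -- This extra condition propagates because `{v, x\y} = {v, x}\y` with `{v, x}` again in `V`.
  have hQ : ∀ x ∈ S, x ∈ Q := by
    let T : Submodule K A :=
      { carrier := {x | x ∈ Q ∧ ∀ v ∈ V, bracket K v x ∈ Q}
        zero_mem' := ⟨zero_mem _, fun y _ => by simp⟩
        add_mem' := fun {a b} ha hb => ⟨add_mem ha.1 hb.1, fun y hy => by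
          rw [map_add]; exact add_mem (ha.2 y hy) (hb.2 y hy)⟩
        smul_mem' := fun c a ha => ⟨Q.smul_mem c ha.1, fun y hy => by
          rw [map_smul]; exact Q.smul_mem c (ha.2 y hy)⟩ }
    have key : ∀ v ∈ V, ∀ x ∈ T, bs v x ∈ Q := by
      intro v hv x hx y hy
      rw [bslash_slash]
      exact add_mem (hL v hv _ (hx.1 y hy)) (hx.2 v hv y hy)
    intro x hx
    refine (hle T ⟨fun x hx => ⟨fun y hy => hL x hx y hy, fun v hv y hy =>
      hL _ (hbr v hv x hx) y hy⟩, fun x hx y hy => ⟨key x hx y hy, fun v hv => ?_⟩⟩ hx).1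
    rw [bracket_bslash]
    exact key _ (hbr v hv x hx) y hy
  have htop : S = ⊤ := hV S hVS (fun x hx y hy => hQ x hx y hy) hb
  exact top_le_iff.1 (htop ▸ hle S' ⟨hVS', hS'⟩)

/-- A linear map that is compatible with both products. -/
structure IsHom {B : Type w} [AddCommGroup B] [Module K B] [DuplicialAlgebra K A]
    [DuplicialAlgebra K B] (g : A →ₗ[K] B) : Prop where
  map_slash : ∀ x y : A, g (sl x y) = sl (g x) (g y)
  map_bslash : ∀ x y : A, g (bs x y) = bs (g x) (g y)

theorem IsHom.map_bracket {B : Type w} [AddCommGroup B] [Module K B] [DuplicialAlgebra K A]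
    [DuplicialAlgebra K B] {g : A →ₗ[K] B} (hg : IsHom g) (x y : A) :
    g (bracket K x y) = bracket K (g x) (g y) := by
  simp only [bracket_apply, map_sub, hg.map_slash, hg.map_bslash]

/-- A homomorphism from an algebra generated by primitive elements that sends the generators to
primitive elements is compatible with the coproducts. -/
theorem IsHom.map_comul {B : Type w} [AddCommGroup B] [Module K B] [DuplicialBialgebra K A]
    [DuplicialBialgebra K B] {g : A →ₗ[K] B} (hg : IsHom g) {V : Submodule K A}
    (hV : Generates V) (hVP : V ≤ Prim K A) (hgV : ∀ x ∈ V, g x ∈ Prim K B) (x : A) :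
    DuplicialBialgebra.comul (K := K) (g x) =
      TensorProduct.map g g (DuplicialBialgebra.comul (K := K) x) := by
  -- The infinitesimal relation determines `Δ` of a product from `Δ` of its factors, so the locus of
  -- agreement is closed under both products.
  let S : Submodule K A := LinearMap.eqLocus (DuplicialBialgebra.comul (K := K) ∘ₗ g)
    (TensorProduct.map g g ∘ₗ DuplicialBialgebra.comul (K := K))
  have hmem : ∀ x, x ∈ S ↔ DuplicialBialgebra.comul (K := K) (g x) =
      TensorProduct.map g g (DuplicialBialgebra.comul (K := K) x) := fun x => Iff.rfl
  have htop : S = ⊤ := by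
    refine hV S (fun x hx => ?_) (fun x hx y hy => ?_) (fun x hx y hy => ?_)
    · have h1 := hVP hx
      have h2 := hgV x hx
      simp only [Prim, LinearMap.mem_ker] at h1 h2
      rw [hmem, h1, h2, map_zero]
    · rw [hmem] at *
      rw [hg.map_slash, DuplicialBialgebra.comul_slash, DuplicialBialgebra.comul_slash,
        map_infinitesimalRHS g (fun x y => (hg.map_slash x y).symm), infinitesimalRHS, hx, hy]
    · rw [hmem] at *
      rw [hg.map_bslash, DuplicialBialgebra.comul_bslash, DuplicialBialgebra.comul_bslash,
        map_infinitesimalRHS g (fun x y => (hg.map_bslash x y).symm), infinitesimalRHS, hx, hy]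
  exact (hmem x).1 (htop ▸ Submodule.mem_top)

end Generation

/-! ### The coradical filtration and connectedness -/

section Filtration

variable {K : Type u} {A : Type v} [Field K] [AddCommGroup A] [Module K A]

theorem range_map_subtype_mono {S S' T T' : Submodule K A} (hS : S ≤ S') (hT : T ≤ T') :
    LinearMap.range (TensorProduct.map S.subtype T.subtype) ≤
      LinearMap.range (TensorProduct.map S'.subtype T'.subtype) := by
  rintro _ ⟨z, rfl⟩
  refine ⟨TensorProduct.map (Submodule.inclusion hS) (Submodule.inclusion hT) z, ?_⟩
  rw [← LinearMap.comp_apply, ← TensorProduct.map_comp]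
  rfl

variable [DuplicialBialgebra K A]

local notation "sl" => DuplicialAlgebra.slash (K := K)
local notation "bs" => DuplicialAlgebra.bslash (K := K)
local notation "cm" => DuplicialBialgebra.comul (K := K)
local notation "Fil" => coradicalFiltration K A

theorem mem_prim_iff {x : A} : x ∈ Prim K A ↔ cm x = 0 := Iff.rfl

theorem mem_coradicalFiltration_succ {n : ℕ} {x : A} :
    x ∈ Fil (n + 1) ↔
      cm x ∈ LinearMap.range (TensorProduct.map (Fil n).subtype (Fil n).subtype) := Iff.rfl

theorem coradicalFiltration_mono : Monotone (coradicalFiltration K A) := by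
  refine monotone_nat_of_le_succ fun n => ?_
  induction n with
  | zero =>
    intro x hx
    rw [mem_coradicalFiltration_succ, mem_prim_iff.1 hx]
    exact zero_mem _
  | succ n ih =>
    intro x hx
    exact range_map_subtype_mono ih ih hx

theorem comul_bslash_of_prim {v x : A} (hv : v ∈ Prim K A) :
    cm (bs v x) = (bs v).rTensor A (cm x) + v ⊗ₜ x := by
  rw [DuplicialBialgebra.comul_bslash, infinitesimalRHS, mem_prim_iff.1 hv]
  simp

/-- Multiplying by a primitive element on the left lengthens a word by one letter: the formula for
`Δ(v\x)` puts `v\x₍₁₎` one stage above `x₍₁₎`, and the extra term `v ⊗ x` has both factors in the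
stage of `x`. -/
theorem bslash_mem_coradicalFiltration {v x : A} (hv : v ∈ Prim K A) {n : ℕ} (hx : x ∈ Fil n) :
    bs v x ∈ Fil (n + 1) := by
  have key : ∀ {n : ℕ} {x : A}, x ∈ Fil n →
      v ⊗ₜ[K] x ∈ LinearMap.range (TensorProduct.map (Fil n).subtype (Fil n).subtype) :=
    fun {n x} hx => ⟨(⟨v, coradicalFiltration_mono (Nat.zero_le n) hv⟩ : Fil n) ⊗ₜ
      (⟨x, hx⟩ : Fil n), rfl⟩
  induction n generalizing x with
  | zero =>
    rw [mem_coradicalFiltration_succ, comul_bslash_of_prim hv, mem_prim_iff.1 hx, map_zero,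
      zero_add]
    exact key hx
  | succ n ih =>
    rw [mem_coradicalFiltration_succ, comul_bslash_of_prim hv]
    refine add_mem ?_ (key hx)
    obtain ⟨z, hz⟩ := mem_coradicalFiltration_succ.1 hx
    rw [← hz]
    clear hz
    induction z with
    | zero => simp
    | add a b ha hb => simpa only [map_add] using add_mem ha hb
    | tmul a b =>
      exact ⟨(⟨bs v (a : A), ih a.2⟩ : Fil (n + 1)) ⊗ₜ
        (⟨b, coradicalFiltration_mono n.le_succ b.2⟩ : Fil (n + 1)), rfl⟩

/-- A bialgebra that is left generated by primitive elements is connected. -/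
theorem LeftGenerates.isConnected {V : Submodule K A} (hV : LeftGenerates V)
    (hVP : V ≤ Prim K A) : IsConnected K A := by
  have h := hV (⨆ n, Fil n) (hVP.trans (le_iSup Fil 0)) (fun x hx y hy => by
    rw [Submodule.mem_iSup_of_directed _ coradicalFiltration_mono.directed_le] at hy ⊢
    obtain ⟨n, hn⟩ := hy
    exact ⟨n + 1, bslash_mem_coradicalFiltration (hVP hx) hn⟩)
  intro x
  rw [← Submodule.mem_iSup_of_directed _ coradicalFiltration_mono.directed_le, h]
  exact Submodule.mem_top

/-- A coalgebra map from a connected bialgebra that is injective on primitive elements is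
injective. -/
theorem IsConnected.injective {B : Type w} [AddCommGroup B] [Module K B] [DuplicialBialgebra K B]
    (hA : IsConnected K A) (g : A →ₗ[K] B)
    (hg : ∀ x : A, cm (g x) = TensorProduct.map g g (cm x))
    (hinj : ∀ x ∈ Prim K A, g x = 0 → x = 0) : Function.Injective g := by
  have key : ∀ n, ∀ x ∈ Fil n, g x = 0 → x = 0 := by
    intro n
    induction n with
    | zero => exact hinj
    | succ n ih =>
      intro x hx hgx
      obtain ⟨z, hz⟩ := mem_coradicalFiltration_succ.1 hx
      have hi : Function.Injective (g ∘ₗ (Fil n).subtype) := by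
        rw [injective_iff_map_eq_zero]
        exact fun a ha => Subtype.ext (ih a a.2 ha)
      -- Over a field, the tensor square of the injective restriction of `g` is injective. It kills
      -- `z`, since its value there is `Δ(g x) = 0`; hence `Δ x = 0`.
      have hz0 : z = 0 := by
        refine TensorProduct.map_injective_of_flat_flat _ _ hi hi ?_
        rw [map_zero, TensorProduct.map_comp, LinearMap.comp_apply, hz, ← hg, hgx, map_zero]
      refine hinj x ?_ hgx
      rw [mem_prim_iff, ← hz, hz0, map_zero]
  rw [injective_iff_map_eq_zero]
  intro x hx
  obtain ⟨n, hn⟩ := hA x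
  exact key n x hn hx

/-! ### The projection onto the primitive elements -/

variable (K A) in
/-- The approximations of the projection on the primitive elements: `e₀ = id` and
`e_{n+1} x = x - ∑ e_n(x₍₁₎) \ x₍₂₎`. -/
noncomputable def primApprox : ℕ → A →ₗ[K] A
  | 0 => LinearMap.id
  | n + 1 => LinearMap.id -
      TensorProduct.lift DuplicialAlgebra.bslash ∘ₗ (primApprox n).rTensor A ∘ₗ
        DuplicialBialgebra.comul

/-- The left tensor factors of `Δ x` lie one stage lower, so only the values of the map on that
stage matter. This is the inductive step of the arguments on `e`. -/
theorem rTensor_comul_congr {B : Type w} [AddCommGroup B] [Module K B] {f g : A →ₗ[K] B} {n : ℕ}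
    (h : ∀ x ∈ Fil n, f x = g x) {x : A} (hx : x ∈ Fil (n + 1)) :
    f.rTensor A (cm x) = g.rTensor A (cm x) := by
  obtain ⟨z, hz⟩ := mem_coradicalFiltration_succ.1 hx
  rw [← hz]
  clear hz
  induction z with
  | zero => simp
  | add a b ha hb => simp only [map_add, ha, hb]
  | tmul a b => simp [h a a.2]

/-- On primitive elements the correction term vanishes; higher up, the correction at one stage uses
only values one stage lower. Thus the approximations are stationary on each stage. -/
theorem primApprox_succ {n : ℕ} {x : A} (hx : x ∈ Fil n) :
    primApprox K A (n + 1) x = primApprox K A n x := by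
  induction n generalizing x with
  | zero => simp [primApprox, mem_prim_iff.1 hx]
  | succ n ih =>
    change x - _ = x - _
    simp only [LinearMap.comp_apply]
    rw [rTensor_comul_congr (fun y hy => ih hy) hx]

theorem primApprox_of_le {n m : ℕ} (hnm : n ≤ m) {x : A} (hx : x ∈ Fil n) :
    primApprox K A m x = primApprox K A n x := by
  induction m, hnm using Nat.le_induction with
  | base => rfl
  | succ m hm ih => rw [primApprox_succ (coradicalFiltration_mono hm hx), ih]

/-- The equation `e x = x - ∑ e(x₍₁₎) \ x₍₂₎`, which characterizes the projection `e` on the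
primitive elements along the products `x \ y`. -/
def IsPrimProj (e : A →ₗ[K] A) : Prop :=
  ∀ x : A, x = e x + TensorProduct.lift (DuplicialAlgebra.bslash (K := K)) (e.rTensor A (cm x))

/-- The limit of the approximations: at each `x` they are eventually constant. -/
theorem IsConnected.exists_proj (hA : IsConnected K A) :
    ∃ e : A →ₗ[K] A, IsPrimProj e := by
  choose N hN using hA
  -- The value does not depend on the chosen stage `N x`; linearity follows by passing to a common
  -- stage.
  have hval : ∀ n x, x ∈ Fil n → primApprox K A (N x) x = primApprox K A n x := by
    intro n x hx
    rw [← primApprox_of_le (le_max_left (N x) n) (hN x), primApprox_of_le (le_max_right _ _) hx]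
  let e : A →ₗ[K] A :=
    { toFun := fun x => primApprox K A (N x) x
      map_add' := fun x y => by
        have hx := coradicalFiltration_mono (le_max_left (N x) (N y)) (hN x)
        have hy := coradicalFiltration_mono (le_max_right (N x) (N y)) (hN y)
        rw [hval _ _ hx, hval _ _ hy, hval _ _ (add_mem hx hy), map_add]
      map_smul' := fun c x => by
        rw [hval _ _ (Submodule.smul_mem _ c (hN x)), map_smul, RingHom.id_apply] }
  have he : ∀ n x, x ∈ Fil n → e x = primApprox K A n x := hval
  refine ⟨e, fun x => ?_⟩
  -- Placing `x` one stage higher lets the recursion be unfolded once, with the factors `x₍₁₎` in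
  -- stage `N x`.
  have hx := coradicalFiltration_mono (N x).le_succ (hN x)
  rw [he _ x hx, rTensor_comul_congr (he (N x)) hx]
  simp [primApprox]

theorem proj_of_prim {e : A →ₗ[K] A} (he : IsPrimProj e) {x : A} (hx : x ∈ Prim K A) : e x = x := by
  have := he x
  rw [mem_prim_iff.1 hx] at this
  simpa using this.symm

/-- In the equation of `e` at `x\y`, the terms from `x₍₁₎ ⊗ (x₍₂₎\y)` and `x ⊗ y` add up to `(∑
e(x₍₁₎)\x₍₂₎ + e(x))\y = x\y`. What remains is `e(x\y) + ∑ e(x\y₍₁₎)\y₍₂₎ = 0`, whose sum vanishes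
by hypothesis; induction on the stage of `y` supplies that hypothesis. -/
theorem proj_bslash_aux {e : A →ₗ[K] A} (he : IsPrimProj e)
    (x y : A) (h2 : (e ∘ₗ bs x).rTensor A (cm y) = 0) :
    e (bs x y) = 0 := by
  have h1 : ∀ z : A ⊗[K] A, TensorProduct.lift (DuplicialAlgebra.bslash (K := K))
      (e.rTensor A (((bs).flip y).lTensor A z)) =
      bs (TensorProduct.lift (DuplicialAlgebra.bslash (K := K)) (e.rTensor A z)) y := by
    intro z
    induction z with
    | zero => simp
    | add a b ha hb => simp only [map_add, ha, hb, LinearMap.add_apply]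
    | tmul a b => simp [DuplicialAlgebra.bslash_bslash]
  have h3 := he (bs x y)
  rw [LinearMap.rTensor_comp_apply] at h2
  rw [DuplicialBialgebra.comul_bslash, infinitesimalRHS] at h3
  simp only [map_add, h1, h2, add_zero, LinearMap.rTensor_tmul,
    TensorProduct.lift.tmul] at h3
  rw [← LinearMap.add_apply, ← map_add, add_comm _ (e x), ← he x] at h3
  simpa using h3.symm

theorem proj_bslash {e : A →ₗ[K] A} (he : IsPrimProj e) (hA : IsConnected K A)
    (x y : A) : e (bs x y) = 0 := by
  obtain ⟨n, hn⟩ := hA y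
  induction n generalizing x y with
  | zero => exact proj_bslash_aux he x y (by
      rw [mem_prim_iff.1 hn, map_zero])
  | succ n ih =>
    refine proj_bslash_aux he x y ?_
    rw [rTensor_comul_congr (f := e ∘ₗ bs x) (g := 0) (fun z hz => ih x z hz) hn]
    simp

/-- Write `m(x ⊗ y) = e(x)\y`, so that `m ∘ Δ + e = id`. By induction the elements `e(x₍₁₎)` are
primitive, and coassociativity gives `Δ(m(Δ x)) = ((m ∘ Δ + e) ⊗ id)(Δ x) = Δ x`. Hence `Δ(e x) =
0`. -/
theorem proj_mem_prim {e : A →ₗ[K] A} (he : IsPrimProj e) (hA : IsConnected K A)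
    (x : A) : e x ∈ Prim K A := by
  obtain ⟨n, hn⟩ := hA x
  induction n generalizing x with
  | zero => rw [proj_of_prim he hn]; exact hn
  | succ n ih =>
    let m : A ⊗[K] A →ₗ[K] A :=
      TensorProduct.lift (DuplicialAlgebra.bslash (K := K)) ∘ₗ e.rTensor A
    obtain ⟨z, hz⟩ := mem_coradicalFiltration_succ.1 hn
    have h1 : ∀ z : Fil n ⊗[K] Fil n,
        cm (m (TensorProduct.map (Fil n).subtype (Fil n).subtype z)) =
          m.rTensor A ((TensorProduct.assoc K A A A).symm
            ((cm).lTensor A (TensorProduct.map (Fil n).subtype (Fil n).subtype z))) +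
          e.rTensor A (TensorProduct.map (Fil n).subtype (Fil n).subtype z) := by
      intro z
      induction z with
      | zero => simp
      | add a b ha hb => simp only [map_add, ha, hb]; abel
      | tmul a b =>
        have h2 : m ((a : A) ⊗ₜ (b : A)) = bs (e a) b := by simp [m]
        simp only [TensorProduct.map_tmul, Submodule.subtype_apply, LinearMap.lTensor_tmul,
          LinearMap.rTensor_tmul]
        rw [h2, comul_bslash_of_prim (ih a a.2)]
        congr 1
        generalize cm (b : A) = w
        induction w with
        | zero => simp
        | add a b ha hb => simp only [map_add, TensorProduct.tmul_add, ha, hb]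
        | tmul c d => simp [m]
    have h3 := h1 z
    rw [hz, ← DuplicialBialgebra.coassoc, LinearEquiv.symm_apply_apply,
      ← LinearMap.rTensor_comp_apply, ← LinearMap.add_apply, ← LinearMap.rTensor_add] at h3
    have h4 : m ∘ₗ cm + e = LinearMap.id := by
      ext y
      rw [LinearMap.id_apply]
      conv_rhs => rw [he y]
      exact add_comm _ _
    rw [h4, LinearMap.rTensor_id_apply] at h3
    have h5 := congrArg cm (he x)
    rw [map_add] at h5
    change _ = _ + cm (m _) at h5
    rw [h3] at h5
    simpa [mem_prim_iff] using h5

/-- A subspace of primitive elements that left generates contains every primitive element. -/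
theorem LeftGenerates.prim_le {V : Submodule K A} (hV : LeftGenerates V) (hVP : V ≤ Prim K A) :
    Prim K A ≤ V := by
  have hA := hV.isConnected hVP
  obtain ⟨e, he⟩ := hA.exists_proj
  -- Since `e` fixes `V` and kills all products, left generation forces every value of `e` into `V`,
  -- while `e` fixes each primitive element.
  have h : V.comap e = ⊤ := by
    refine hV _ (fun x hx => ?_) (fun x _ y _ => ?_)
    · rw [Submodule.mem_comap, proj_of_prim he (hVP hx)]; exact hx
    · rw [Submodule.mem_comap, proj_bslash he hA]; exact zero_mem _
  intro x hx
  have h2 : x ∈ V.comap e := h ▸ Submodule.mem_top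
  rwa [Submodule.mem_comap, proj_of_prim he hx] at h2

/-- A connected bialgebra is left generated by its primitive elements. -/
theorem IsConnected.leftGenerates (hA : IsConnected K A) : LeftGenerates (Prim K A) := by
  obtain ⟨e, he⟩ := hA.exists_proj
  intro S hPS hS
  have key : ∀ n, ∀ x ∈ Fil n, x ∈ S := by
    intro n
    induction n with
    | zero => exact fun x hx => hPS hx
    | succ n ih =>
      intro x hx
      rw [he x]
      refine add_mem (hPS (proj_mem_prim he hA x)) ?_
      obtain ⟨z, hz⟩ := mem_coradicalFiltration_succ.1 hx
      rw [← hz]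
      clear hz
      induction z with
      | zero => simp
      | add a b ha hb => simpa only [map_add] using add_mem ha hb
      | tmul a b =>
        simpa using hS _ (proj_mem_prim he hA (a : A)) _ (ih b b.2)
  rw [eq_top_iff]
  intro x _
  obtain ⟨n, hn⟩ := hA x
  exact key n x hn

end Filtration

/-! A duplicial algebra on the tensor words in a magmatic algebra -/

/-- The space `⨁_{n ≥ 1} M^{⊗ n}` of nonempty tensor words in `M`, as
`M ⊗ T(M)`. -/
abbrev Words (K : Type u) (M : Type v) [Field K] [AddCommGroup M] [Module K M] : Type (max u v) :=
  M ⊗[K] TensorAlgebra K M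

namespace Words

variable {K : Type u} {M : Type v} [Field K] [AddCommGroup M] [Module K M]

variable (K M) in
/-- A nonempty word as an element of the tensor algebra. -/
noncomputable def toTensor : Words K M →ₗ[K] TensorAlgebra K M :=
  TensorProduct.lift ((LinearMap.mul K (TensorAlgebra K M)) ∘ₗ TensorAlgebra.ι K)

@[simp]
theorem toTensor_tmul (p : M) (t : TensorAlgebra K M) :
    toTensor K M (p ⊗ₜ t) = TensorAlgebra.ι K p * t := rfl

variable (K M) in
/-- Concatenation of words. -/
noncomputable def concat : Words K M →ₗ[K] Words K M →ₗ[K] Words K M :=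
  TensorProduct.lift (LinearMap.mk₂ K
    (fun p t => TensorProduct.mk K M _ p ∘ₗ LinearMap.mulLeft K t ∘ₗ toTensor K M)
    (fun _ _ _ => by ext; simp)
    (fun _ _ _ => by ext; simp [TensorProduct.smul_tmul'])
    (fun _ _ _ => by ext; simp [add_mul, TensorProduct.tmul_add])
    (fun _ _ _ => by ext; simp))

@[simp]
theorem concat_tmul (p : M) (t : TensorAlgebra K M) (x : Words K M) :
    concat K M (p ⊗ₜ t) x = p ⊗ₜ (t * toTensor K M x) := rfl

theorem toTensor_concat (x y : Words K M) :
    toTensor K M (concat K M x y) = toTensor K M x * toTensor K M y := by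
  induction x using TensorProduct.induction_on with
  | zero => simp
  | add a b ha hb => simp only [map_add, LinearMap.add_apply, ha, hb, add_mul]
  | tmul p t => simp [mul_assoc]

theorem concat_assoc (x y z : Words K M) :
    concat K M x (concat K M y z) = concat K M (concat K M x y) z := by
  induction x using TensorProduct.induction_on with
  | zero => simp
  | add a b ha hb => simp only [map_add, LinearMap.add_apply, ha, hb]
  | tmul p t => simp [mul_assoc, toTensor_concat]

variable (μ : M →ₗ[K] M →ₗ[K] M)

/-- The action of `p : M` on words: `x₁ x₂ ⋯ xₙ ↦ (p · x₁) x₂ ⋯ xₙ`. -/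
noncomputable def act : M →ₗ[K] Module.End K (Words K M) :=
  (LinearMap.rTensorHom (TensorAlgebra K M)) ∘ₗ μ

@[simp]
theorem act_tmul (p q : M) (t : TensorAlgebra K M) : act μ p (q ⊗ₜ t) = μ p q ⊗ₜ t := rfl

variable (K M) in
/-- A letter as a word. -/
noncomputable def letter : M →ₗ[K] Words K M := (TensorProduct.mk K M (TensorAlgebra K M)).flip 1

theorem letter_apply (p : M) : letter K M p = p ⊗ₜ 1 := rfl

/-- Left `/`-multiplication by a letter: `p / x = p x - (p · x₁) x₂ ⋯ xₙ`. -/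
noncomputable def letterSlash : M →ₗ[K] Module.End K (Words K M) :=
  concat K M ∘ₗ letter K M - act μ

theorem letterSlash_apply (p : M) (x : Words K M) :
    letterSlash μ p x = concat K M (letter K M p) x - act μ p x := rfl

/-- The operator `(φ, y) ↦ (p ↦ L_p φ(y) + φ(p · y))`. -/
noncomputable def slashStep : M →ₗ[K] Module.End K (M →ₗ[K] Module.End K (Words K M)) :=
  LinearMap.mk₂ K
    (fun y φ => (LinearMap.mulRight K (φ y)) ∘ₗ letterSlash μ + φ ∘ₗ μ.flip y)
    (fun _ _ _ => by ext1; simp [mul_add]; abel)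
    (fun _ _ _ => by ext1; simp)
    (fun _ _ _ => by ext1; simp [mul_add]; abel)
    (fun _ _ _ => by ext1; simp)

theorem slashStep_apply (y : M) (φ : M →ₗ[K] Module.End K (Words K M)) (p : M) :
    slashStep μ y φ p = letterSlash μ p * φ y + φ (μ p y) := rfl

/-- The product `/` on words, determined by
`(p w) / z = p / (w / z) + ((p · w₁) w₂ ⋯ wₙ) / z`. -/
noncomputable def slash : Words K M →ₗ[K] Module.End K (Words K M) :=
  TensorProduct.lift
    -- Each letter acts on maps `M → End` by `slashStep`, hence so does the whole tensor algebra.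
    -- Acting by `t` on the base case `letterSlash μ` yields `p ↦ (p ⊗ t) / ·`, which solves the
    -- recursion without choosing a basis of `M`.
    (LinearMap.applyₗ (letterSlash μ) ∘ₗ
      (TensorAlgebra.lift K (slashStep μ)).toLinearMap).flip

theorem slash_tmul (p : M) (t : TensorAlgebra K M) :
    slash μ (p ⊗ₜ t) = TensorAlgebra.lift K (slashStep μ) t (letterSlash μ) p := rfl

theorem slash_letter (p : M) : slash μ (letter K M p) = letterSlash μ p := by
  simp [letter_apply, slash_tmul]

/-- The recursion that `bslash_slash` forces once the bracket with the letter `p` is `act μ p`. -/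
theorem slash_letter_concat (p : M) (x : Words K M) :
    slash μ (concat K M (letter K M p) x) =
      letterSlash μ p * slash μ x + slash μ (act μ p x) := by
  induction x using TensorProduct.induction_on with
  | zero => simp
  | add a b ha hb => simp only [map_add, mul_add, ha, hb]; abel
  | tmul q t => simp [letter_apply, slash_tmul, slashStep_apply]

/-- Associativity of `/` with a letter in first place: the term subtracted in `letterSlash` cancels
the second term of the recursion. -/
theorem slash_letterSlash (p : M) (x : Words K M) :
    slash μ (letterSlash μ p x) = letterSlash μ p * slash μ x := by
  rw [letterSlash_apply, map_sub, slash_letter_concat, add_sub_cancel_right]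

/-- Induction on the length of words. -/
theorem induction_length {P : Submodule K (Words K M)} (h1 : ∀ p, letter K M p ∈ P)
    (hc : ∀ t, (∀ q, q ⊗ₜ t ∈ P) → ∀ p q, concat K M (letter K M p) (q ⊗ₜ t) ∈ P)
    (x : Words K M) : x ∈ P := by
  -- Generalizing over the suffix `s` makes the statement multiplicative in `t`. Quantifying over
  -- all first letters is necessary because the recursion replaces a first letter `q` by `p · q`.
  have key : ∀ t s : TensorAlgebra K M, (∀ p : M, p ⊗ₜ s ∈ P) → ∀ p : M, p ⊗ₜ (t * s) ∈ P := by
    intro t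
    induction t using TensorAlgebra.induction with
    | algebraMap r =>
      intro s hs p
      rw [← Algebra.smul_def, TensorProduct.tmul_smul]
      exact P.smul_mem r (hs p)
    | ι q =>
      intro s hs p
      simpa [letter_apply] using hc s hs p q
    | mul a b ha hb =>
      intro s hs p
      rw [mul_assoc]
      exact ha _ (hb _ hs) p
    | add a b ha hb =>
      intro s hs p
      rw [add_mul, TensorProduct.tmul_add]
      exact add_mem (ha s hs p) (hb s hs p)
  induction x using TensorProduct.induction_on with
  | zero => exact zero_mem _
  | add a b ha hb => exact add_mem ha hb
  | tmul p t =>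
    rw [← mul_one t]
    exact key t 1 h1 p

theorem letterSlash_concat (p : M) (x y : Words K M) :
    letterSlash μ p (concat K M x y) = concat K M (letterSlash μ p x) y := by
  have : act μ p (concat K M x y) = concat K M (act μ p x) y := by
    induction x using TensorProduct.induction_on with
    | zero => simp
    | add a b ha hb => simp only [map_add, LinearMap.add_apply, ha, hb]
    | tmul p t => simp
  rw [letterSlash_apply, letterSlash_apply, map_sub, LinearMap.sub_apply, this, concat_assoc]

/-- A letter acts by `/` only at the front of a word, so it commutes with appending `z`; the
recursion extends this to all `x`. -/
theorem slash_concat (x y z : Words K M) :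
    slash μ x (concat K M y z) = concat K M (slash μ x y) z := by
  let P : Submodule K (Words K M) :=
    { carrier := {x | ∀ y, slash μ x (concat K M y z) = concat K M (slash μ x y) z}
      zero_mem' := fun y => by simp
      add_mem' := fun {a b} ha hb y => by
        simp only [map_add, LinearMap.add_apply, ha y, hb y]
      smul_mem' := fun c a ha y => by
        simp only [map_smul, LinearMap.smul_apply, ha y] }
  refine induction_length (P := P) (fun p y => ?_) (fun t ht p q y => ?_) x y
  · rw [slash_letter, letterSlash_concat]
  · rw [slash_letter_concat, act_tmul, LinearMap.add_apply, LinearMap.add_apply,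
      Module.End.mul_apply, Module.End.mul_apply, ht q y, ht (μ p q) y, letterSlash_concat,
      map_add, LinearMap.add_apply]

/-- Induction on the first argument: both sides satisfy the same recursion, by `slash_letterSlash`.
-/
theorem slash_slash (x y : Words K M) : slash μ (slash μ x y) = slash μ x * slash μ y := by
  let P : Submodule K (Words K M) :=
    { carrier := {x | slash μ (slash μ x y) = slash μ x * slash μ y}
      zero_mem' := by simp
      add_mem' := fun {a b} ha hb => by
        rw [Set.mem_ofPred_eq] at *
        simp only [map_add, LinearMap.add_apply, ha, hb, add_mul]
      smul_mem' := fun c a ha => by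
        rw [Set.mem_ofPred_eq] at *
        simp only [map_smul, LinearMap.smul_apply, ha, smul_mul_assoc] }
  have hP : ∀ x, x ∈ P ↔ slash μ (slash μ x y) = slash μ x * slash μ y := fun x => Iff.rfl
  refine (hP x).1 (induction_length (fun p => ?_) (fun t ht p q => ?_) x)
  · rw [hP, slash_letter, slash_letterSlash]
  · have h1 := (hP _).1 (ht q)
    have h2 := (hP _).1 (ht (μ p q))
    rw [hP, slash_letter_concat, act_tmul, LinearMap.add_apply, Module.End.mul_apply, map_add,
      slash_letterSlash, h1, h2, add_mul, mul_assoc]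

/-- The duplicial algebra of words in a magmatic algebra. -/
@[reducible]
noncomputable def duplicialAlgebra : DuplicialAlgebra K (Words K M) where
  slash := slash μ
  bslash := concat K M
  slash_slash x y z := by rw [slash_slash]; rfl
  slash_bslash := slash_concat μ
  bslash_bslash := concat_assoc

theorem bracket_letter (p q : M) :
    @bracket K (Words K M) _ _ _ (duplicialAlgebra μ) (letter K M p) (letter K M q) = letter K M (μ p q) := by
  change concat K M (letter K M p) (letter K M q) - slash μ (letter K M p) (letter K M q) = _
  rw [slash_letter, letterSlash_apply, sub_sub_cancel, letter_apply, act_tmul, letter_apply]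

theorem letter_injective : Function.Injective (letter K M) := by
  refine Function.LeftInverse.injective (g := (TensorProduct.rid K M).toLinearMap ∘ₗ
    (TensorAlgebra.algebraMapInv (R := K) (M := M)).toLinearMap.lTensor M) fun p => ?_
  simp [letter_apply]

end Words

/-! The universal properties -/

section Universal

variable {K : Type u} {A : Type v} [Field K] [AddCommGroup A] [Module K A]

local notation "sl" => DuplicialAlgebra.slash (K := K)
local notation "bs" => DuplicialAlgebra.bslash (K := K)

/-! ### The universal property of the free duplicial algebra -/

namespace Dup

variable {E : Type w}

/-- A tree with root `e` and subtrees `l`, `r` is `(l/e)\r`, with empty subtrees omitted. -/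
theorem generates {V : Submodule K (Dup K E)} (hV : ∀ e, gen K e ∈ V) : Generates V := by
  intro S hVS hs hb
  have h : ∀ t : BinaryTree E, ofTree K t ∈ S := by
    intro t
    induction t with
    | nil => exact zero_mem _
    | node e l r ihl ihr =>
      have hl : ofTree K (.node e l .nil) ∈ S := by
        by_cases h : l = .nil
        · subst h; exact hVS (hV e)
        · rw [ofTree_left K e h]; exact hs _ ihl _ (hVS (hV e))
      by_cases h : r = .nil
      · subst h; exact hl
      · rw [ofTree_right K e l h]; exact hb _ hl _ ihr
  rw [eq_top_iff]
  intro x _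
  induction x using induction_on with
  | h0 => exact zero_mem _
  | hadd a b ha hb => exact add_mem (ha trivial) (hb trivial)
  | hsmul c a ha => exact S.smul_mem c (ha trivial)
  | h t _ => exact h t

variable [DuplicialAlgebra K A] (f : E → A)

variable (K) in
/-- The value in a duplicial algebra of a tree whose colours are evaluated by `f`; the tree `|`
has the junk value `0`. -/
noncomputable def evalTree : BinaryTree E → A
  | .nil => 0
  | .node e .nil .nil => f e
  | .node e .nil r => bs (f e) (evalTree r)
  | .node e l .nil => sl (evalTree l) (f e)
  | .node e l r => bs (sl (evalTree l) (f e)) (evalTree r)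

theorem evalTree_left (e : E) {l : BinaryTree E} (hl : l ≠ .nil) :
    evalTree K f (.node e l .nil) = sl (evalTree K f l) (f e) := by
  cases l with
  | nil => exact absurd rfl hl
  | node => rw [evalTree]; simp

theorem evalTree_right (e : E) (l : BinaryTree E) {r : BinaryTree E} (hr : r ≠ .nil) :
    evalTree K f (.node e l r) = bs (evalTree K f (.node e l .nil)) (evalTree K f r) := by
  cases r with
  | nil => exact absurd rfl hr
  | node => cases l <;> simp [evalTree]

theorem evalTree_treeSlash {t s : BinaryTree E} (ht : t ≠ .nil) (hs : s ≠ .nil) :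
    evalTree K f (treeSlash t s) = sl (evalTree K f t) (evalTree K f s) := by
  induction s with
  | nil => exact absurd rfl hs
  | node e l r ihl ihr =>
    have hl : evalTree K f (.node e (treeSlash t l) .nil) =
        sl (evalTree K f t) (evalTree K f (.node e l .nil)) := by
      rw [evalTree_left f e (treeSlash_ne ht)]
      by_cases h : l = .nil
      · subst h; simp [treeSlash, evalTree]
      · rw [ihl h, evalTree_left f e h, DuplicialAlgebra.slash_slash]
    rw [treeSlash]
    by_cases h : r = .nil
    · subst h; exact hl
    · rw [evalTree_right f e _ h, hl, evalTree_right f e _ h, DuplicialAlgebra.slash_bslash]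

theorem evalTree_treeBslash {t s : BinaryTree E} (ht : t ≠ .nil) (hs : s ≠ .nil) :
    evalTree K f (treeBslash t s) = bs (evalTree K f t) (evalTree K f s) := by
  induction t with
  | nil => exact absurd rfl ht
  | node e l r ihl ihr =>
    rw [treeBslash, evalTree_right f e _ (treeBslash_ne hs)]
    by_cases h : r = .nil
    · subst h; simp [treeBslash]
    · rw [ihr h, evalTree_right f e l h, DuplicialAlgebra.bslash_bslash]

variable (K) in
/-- The homomorphism from the free duplicial algebra that extends `f`. -/
noncomputable def lift : Dup K E →ₗ[K] A := extend (evalTree K f)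

theorem lift_gen (e : E) : lift K f (gen K e) = f e := by
  rw [lift, gen, extend_ofTree _ (by simp), evalTree]

theorem lift_isHom : IsHom (lift K f) where
  map_slash x y := by
    change lift K f (slash K E x y) = _
    induction x using induction_on with
    | h0 => simp
    | hadd a b ha hb => simp only [map_add, LinearMap.add_apply, ha, hb]
    | hsmul c a ha => simp only [map_smul, LinearMap.smul_apply, ha]
    | h t ht =>
    induction y using induction_on with
    | h0 => simp
    | hadd a b ha hb => simp only [map_add, ha, hb]
    | hsmul c a ha => simp only [map_smul, ha]
    | h s hs =>
      rw [slash_ofTree ht hs, lift, extend_ofTree _ ht, extend_ofTree _ hs,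
        extend_ofTree _ (treeSlash_ne ht), evalTree_treeSlash f ht hs]
  map_bslash x y := by
    change lift K f (bslash K E x y) = _
    induction x using induction_on with
    | h0 => simp
    | hadd a b ha hb => simp only [map_add, LinearMap.add_apply, ha, hb]
    | hsmul c a ha => simp only [map_smul, LinearMap.smul_apply, ha]
    | h t ht =>
    induction y using induction_on with
    | h0 => simp
    | hadd a b ha hb => simp only [map_add, ha, hb]
    | hsmul c a ha => simp only [map_smul, ha]
    | h s hs =>
      rw [bslash_ofTree ht hs, lift, extend_ofTree _ ht, extend_ofTree _ hs,
        extend_ofTree _ (treeBslash_ne hs), evalTree_treeBslash f ht hs]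

end Dup

theorem inclusion_basis {M : Type v} [AddCommGroup M] [Module K M] {ι : Type w}
    (b : Module.Basis ι K M) (i : ι) : inclusion b (b i) = Dup.gen K i := by
  simp [inclusion]

/-! ### The enveloping algebra and its primitive part -/

namespace UDup

variable {M : Type w'} [AddCommGroup M] [Module K M] {ι : Type w}
  (μ : M →ₗ[K] M →ₗ[K] M) (b : Module.Basis ι K M)

variable (K) in
/-- The projection of the free duplicial algebra on the enveloping algebra. -/
noncomputable def mk : Dup K ι →ₗ[K] UDup μ b := (idealSpan K (relations μ b)).mkQ

theorem mk_surjective : Function.Surjective (mk K μ b) := Submodule.mkQ_surjective _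

theorem mk_isHom : IsHom (mk K μ b) := ⟨fun _ _ => rfl, fun _ _ => rfl⟩

theorem mk_inclusion (x : M) : mk K μ b (inclusion b x) = of μ b x := rfl

theorem mk_gen (i : ι) : mk K μ b (Dup.gen K i) = of μ b (b i) := by
  rw [← mk_inclusion, inclusion_basis]

theorem bracket_of (x y : M) : bracket K (of μ b x) (of μ b y) = of μ b (μ x y) := by
  rw [← mk_inclusion, ← mk_inclusion, ← mk_inclusion, ← (mk_isHom μ b).map_bracket, ← sub_eq_zero,
    ← map_sub]
  refine (Submodule.Quotient.mk_eq_zero _).2 (Submodule.mem_sInf.2 fun I hI => hI.2 ⟨x, y, rfl⟩)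

theorem of_mem_prim (x : M) : of μ b x ∈ Prim K (UDup μ b) := by
  have h := inclusion_mem_prim b x
  change quotientComul _ _ _ (Submodule.mkQ _ (inclusion b x)) = 0
  rw [quotientComul_mk, mem_prim_iff.1 h, map_zero]

theorem range_of_le_prim : LinearMap.range (of μ b) ≤ Prim K (UDup μ b) := by
  rintro _ ⟨x, rfl⟩
  exact of_mem_prim μ b x

theorem generates_range_of : Generates (LinearMap.range (of μ b)) := by
  intro S hS hs hb
  have h : S.comap (mk K μ b) = ⊤ := by
    refine Dup.generates (V := S.comap (mk K μ b)) (fun i => ?_) _ le_rfl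
      (fun x hx y hy => ?_) (fun x hx y hy => ?_)
    · rw [Submodule.mem_comap, mk_gen]; exact hS ⟨_, rfl⟩
    · rw [Submodule.mem_comap, (mk_isHom μ b).map_slash]; exact hs _ hx _ hy
    · rw [Submodule.mem_comap, (mk_isHom μ b).map_bslash]; exact hb _ hx _ hy
  rw [eq_top_iff]
  intro x _
  obtain ⟨x, rfl⟩ := mk_surjective μ b x
  have : x ∈ S.comap (mk K μ b) := h ▸ Submodule.mem_top
  exact this

/-- The defining relations make the image of `M` closed under the bracket. -/
theorem leftGenerates_range_of : LeftGenerates (LinearMap.range (of μ b)) := by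
  refine (generates_range_of μ b).leftGenerates ?_
  rintro _ ⟨x, rfl⟩ _ ⟨y, rfl⟩
  exact ⟨μ x y, (bracket_of μ b x y).symm⟩

theorem prim_eq_range_of : Prim K (UDup μ b) = LinearMap.range (of μ b) :=
  le_antisymm ((leftGenerates_range_of μ b).prim_le (range_of_le_prim μ b)) (range_of_le_prim μ b)

/-- A linear map from `M` to a duplicial algebra that turns products into brackets extends to the
enveloping algebra. -/
theorem exists_lift [DuplicialAlgebra K A] (g : M →ₗ[K] A)
    (hg : ∀ x y, g (μ x y) = bracket K (g x) (g y)) :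
    ∃ φ : UDup μ b →ₗ[K] A, IsHom φ ∧ ∀ x, φ (of μ b x) = g x := by
  let F : Dup K ι →ₗ[K] A := Dup.lift K (g ∘ b)
  have hF : IsHom F := Dup.lift_isHom _
  have hinc : ∀ x, F (inclusion b x) = g x := by
    have : F ∘ₗ inclusion b = g := b.ext fun i => by
      rw [LinearMap.comp_apply, inclusion_basis]; exact Dup.lift_gen _ i
    exact fun x => LinearMap.congr_fun this x
  have hI : idealSpan K (relations μ b) ≤ LinearMap.ker F := by
    refine idealSpan_le (fun x hx y => ?_) ?_
    · rw [LinearMap.mem_ker] at hx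
      simp only [LinearMap.mem_ker, hF.map_slash, hF.map_bslash, hx, map_zero,
        LinearMap.zero_apply, and_self]
    · rintro _ ⟨x, y, rfl⟩
      simp only [SetLike.mem_coe, LinearMap.mem_ker, map_sub, hF.map_bracket, hinc, hg, sub_self]
  let φ : UDup μ b →ₗ[K] A := Submodule.liftQ _ F hI
  have hφ : ∀ x, φ (mk K μ b x) = F x := fun x => rfl
  refine ⟨φ, ⟨fun x y => ?_, fun x y => ?_⟩, fun x => ?_⟩
  · obtain ⟨x, rfl⟩ := mk_surjective μ b x
    obtain ⟨y, rfl⟩ := mk_surjective μ b y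
    rw [← (mk_isHom μ b).map_slash, hφ, hφ, hφ, hF.map_slash]
  · obtain ⟨x, rfl⟩ := mk_surjective μ b x
    obtain ⟨y, rfl⟩ := mk_surjective μ b y
    rw [← (mk_isHom μ b).map_bslash, hφ, hφ, hφ, hF.map_bslash]
  · rw [← mk_inclusion, hφ, hinc]

/-- The embedding of `M` as letters of the word algebra turns products into brackets, so it factors
through `of μ b`. -/
theorem of_injective : Function.Injective (of μ b) := by
  obtain ⟨φ, -, hφ⟩ := @exists_lift K (Words K M) _ _ _ M _ _ ι μ b (Words.duplicialAlgebra μ)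
    (Words.letter K M) (fun x y => (Words.bracket_letter μ x y).symm)
  exact Function.Injective.of_comp (f := φ) (by
    have : φ ∘ of μ b = Words.letter K M := funext hφ
    rw [this]; exact Words.letter_injective)

/-- A magmatic algebra is isomorphic to the primitive part of its enveloping algebra. -/
theorem exists_prim_equiv : ∃ ψ : M ≃ₗ[K] Prim K (UDup μ b),
    (∀ x y : M, ψ (μ x y) = primBracket K (UDup μ b) (ψ x) (ψ y)) ∧
      ∀ x : M, (ψ x : UDup μ b) = of μ b x := by
  let ψ : M ≃ₗ[K] Prim K (UDup μ b) := (LinearEquiv.ofInjective _ (of_injective μ b)).trans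
    (LinearEquiv.ofEq _ _ (prim_eq_range_of μ b).symm)
  have h : ∀ x : M, (ψ x : UDup μ b) = of μ b x := fun x => rfl
  refine ⟨ψ, fun x y => Subtype.ext ?_, h⟩
  change _ = bracket K (ψ x : UDup μ b) (ψ y : UDup μ b)
  rw [h, h, h, bracket_of]

end UDup

/-! ### Structure theorem and freeness of the primitive part -/

/-- A connected duplicial bialgebra is the enveloping algebra of its primitive part. -/
theorem IsConnected.exists_equiv [DuplicialBialgebra K A] (hA : IsConnected K A) {ι : Type w}
    (b : Module.Basis ι K (Prim K A)) :
    ∃ φ : UDup (primBracket K A) b ≃ₗ[K] A, IsBialgebraIso K φ ∧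
      ∀ x : Prim K A, φ (UDup.of (primBracket K A) b x) = (x : A) := by
  obtain ⟨φ, hφ, hof⟩ := UDup.exists_lift (primBracket K A) b (Prim K A).subtype
    (fun x y => rfl)
  have hcomul := hφ.map_comul (UDup.generates_range_of _ b) (UDup.range_of_le_prim _ b) (by
    rintro _ ⟨x, rfl⟩
    rw [hof]; exact x.2)
  -- The source is connected, and its primitive elements are the classes of elements of `Prim K A`,
  -- on which `φ` is the identity.
  have hinj : Function.Injective φ := by
    refine ((UDup.leftGenerates_range_of _ b).isConnected
      (UDup.range_of_le_prim _ b)).injective φ hcomul fun x hx h0 => ?_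
    rw [UDup.prim_eq_range_of] at hx
    obtain ⟨y, rfl⟩ := hx
    rw [hof] at h0
    rw [show y = 0 from Subtype.ext h0, map_zero]
  have hsurj : LinearMap.range φ = ⊤ := by
    refine hA.leftGenerates _ (fun x hx => ⟨_, hof ⟨x, hx⟩⟩) ?_
    rintro x hx _ ⟨y, rfl⟩
    exact ⟨bs (UDup.of _ b ⟨x, hx⟩) y, by rw [hφ.map_bslash, hof]; rfl⟩
  exact ⟨LinearEquiv.ofBijective φ ⟨hinj, LinearMap.range_eq_top.1 hsurj⟩,
    ⟨hφ.map_slash, hφ.map_bslash, hcomul⟩, hof⟩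

/-- The primitive part of the free duplicial algebra is generated by `E` as a magmatic algebra. -/
theorem Dup.prim_induction {E : Type w} {P : Submodule K (Prim K (Dup K E))}
    (hP : ∀ x ∈ P, ∀ y ∈ P, primBracket K (Dup K E) x y ∈ P) (hgen : ∀ e, primGen K e ∈ P) :
    P = ⊤ := by
  let V : Submodule K (Dup K E) := P.map (Prim K (Dup K E)).subtype
  have hV : LeftGenerates V := by
    refine (generates (V := V) fun e => ⟨_, hgen e, rfl⟩).leftGenerates ?_
    rintro _ ⟨x, hx, rfl⟩ _ ⟨y, hy, rfl⟩
    exact ⟨_, hP x hx y hy, rfl⟩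
  have hle := hV.prim_le (Submodule.map_subtype_le _ _)
  rw [eq_top_iff]
  intro x _
  obtain ⟨y, hy, hxy⟩ := hle x.2
  rwa [← Subtype.ext hxy]

/-- The primitive part of the free duplicial algebra is a free magmatic algebra. -/
theorem Dup.existsUnique_prim_lift {E : Type w} {N : Type w'} [AddCommGroup N] [Module K N]
    (ν : N →ₗ[K] N →ₗ[K] N) (f : E → N) :
    ∃! θ : Prim K (Dup K E) →ₗ[K] N,
      (∀ x y : Prim K (Dup K E), θ (primBracket K (Dup K E) x y) = ν (θ x) (θ y)) ∧
        ∀ e : E, θ (primGen K e) = f e := by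
  -- The target `N` is replaced by the primitive part of its enveloping algebra, so that `θ` can be
  -- obtained by restricting a homomorphism of duplicial algebras.
  let b := Module.Basis.ofVectorSpace K N
  obtain ⟨ψ, hψ, hof⟩ := UDup.exists_prim_equiv ν b
  let F : Dup K E →ₗ[K] UDup ν b := lift K fun e => UDup.of ν b (f e)
  have hF : IsHom F := lift_isHom _
  have hcomul : ∀ x, DuplicialBialgebra.comul (K := K) (F x) =
      TensorProduct.map F F (DuplicialBialgebra.comul (K := K) x) := by
    -- That `F` preserves all primitive elements is not yet known; the intersection contains the
    -- generators and meets both requirements by construction.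
    refine hF.map_comul (V := Prim K (Dup K E) ⊓ (Prim K (UDup ν b)).comap F)
      (generates fun e => ⟨gen_mem_prim e, ?_⟩) inf_le_left fun x hx => hx.2
    rw [SetLike.mem_coe, Submodule.mem_comap, lift_gen]
    exact UDup.of_mem_prim ν b _
  have hFP : ∀ x ∈ Prim K (Dup K E), F x ∈ Prim K (UDup ν b) := by
    intro x hx
    rw [mem_prim_iff] at *
    rw [hcomul, hx, map_zero]
  let θ : Prim K (Dup K E) →ₗ[K] N := ψ.symm.toLinearMap ∘ₗ F.restrict hFP
  have hθ : ∀ x, ψ (θ x) = ⟨F x, hFP x x.2⟩ := fun x => ψ.apply_symm_apply _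
  have hθbr : ∀ x y, θ (primBracket K (Dup K E) x y) = ν (θ x) (θ y) := by
    intro x y
    refine ψ.injective ?_
    rw [hψ, hθ, hθ, hθ]
    exact Subtype.ext (hF.map_bracket _ _)
  have hθgen : ∀ e, θ (primGen K e) = f e := by
    intro e
    refine ψ.injective (Subtype.ext ?_)
    rw [hθ, hof]
    exact lift_gen _ e
  refine ⟨θ, ⟨hθbr, hθgen⟩, ?_⟩
  rintro θ' ⟨h1, h2⟩
  have h : LinearMap.eqLocus θ' θ = ⊤ := by
    refine prim_induction (fun x hx y hy => ?_) fun e => ?_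
    · rw [LinearMap.mem_eqLocus] at *
      rw [h1, hθbr, hx, hy]
    · rw [LinearMap.mem_eqLocus, h2, hθgen]
  exact LinearMap.ext fun x => LinearMap.mem_eqLocus.1 (h ▸ Submodule.mem_top)

end Universal

end Duplicial

theorem mainTheorem7 (K : Type u) [Field K] :
    (∀ (A : Type v) [AddCommGroup A] [Module K A] [DuplicialBialgebra K A],
      Duplicial.IsConnected K A →
      ∀ (ι : Type w) (b : Module.Basis ι K (Duplicial.Prim K A)),
        ∃ φ : Duplicial.UDup (Duplicial.primBracket K A) b ≃ₗ[K] A,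
          Duplicial.IsBialgebraIso K φ ∧
          ∀ x : Duplicial.Prim K A,
            φ (Duplicial.UDup.of (Duplicial.primBracket K A) b x) = (x : A)) ∧
    (∀ (M : Type v) [AddCommGroup M] [Module K M] (μ : M →ₗ[K] M →ₗ[K] M)
      (ι : Type w) (b : Module.Basis ι K M),
        ∃ ψ : M ≃ₗ[K] Duplicial.Prim K (Duplicial.UDup μ b),
          (∀ x y : M, ψ (μ x y) =
            Duplicial.primBracket K (Duplicial.UDup μ b) (ψ x) (ψ y)) ∧
          ∀ x : M, (ψ x : Duplicial.UDup μ b) = Duplicial.UDup.of μ b x) ∧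
    (∀ (E : Type w) (N : Type w') [AddCommGroup N] [Module K N]
      (ν : N →ₗ[K] N →ₗ[K] N) (f : E → N),
        ∃! θ : Duplicial.Prim K (Duplicial.Dup K E) →ₗ[K] N,
          (∀ x y : Duplicial.Prim K (Duplicial.Dup K E),
            θ (Duplicial.primBracket K (Duplicial.Dup K E) x y) = ν (θ x) (θ y)) ∧
          ∀ e : E, θ (Duplicial.Dup.primGen K e) = f e) :=
  ⟨fun _ _ _ _ hA _ b => hA.exists_equiv b,
    fun _ _ _ μ _ b => Duplicial.UDup.exists_prim_equiv μ b,
    fun _ _ _ _ ν f => Duplicial.Dup.existsUnique_prim_lift ν f⟩
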